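/- An $n$-vertex finite simple graph $G$ is called $\alpha$-expanding if every set $X\subseteq V(G)$ with $|X|\le n/2$ satisfies $|N_G(X)|\ge \alpha|X|$, where $N_G(X)$ denotes the set of vertices outside $X$ that have a neighbor in $X$. Let $k>1$ be an integer, and let $p$ be the smallest prime divisor of $k$. Then for every $\alpha>\frac{1}{p-1}$ there exists $n_0=n_0(\alpha,k)\in\mathbb{N}$ such that for each $r\in\{0,1,\ldots,k-1\}$ every $\alpha$-expanding graph on at least $n_0$ vertices contains a cycle of length congruent to $r$ modulo $k$. -/

import Mathlib

/-- The external neighborhood `N_G(X)`: the vertices outside `X` that have a neighbor in `X`. -/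
def externalNeighborhood {V : Type*} (G : SimpleGraph V) (X : Set V) : Set V :=
  {v | v ∉ X ∧ ∃ u ∈ X, G.Adj u v}

/-- A finite graph `G` on `n` vertices is `α`-expanding if every set `X` of at most `n / 2`
vertices satisfies `|N_G(X)| ≥ α |X|`. -/
def IsExpanding {V : Type*} [Finite V] (α : ℝ) (G : SimpleGraph V) : Prop :=
  ∀ X : Set V, (X.ncard : ℝ) ≤ (Nat.card V : ℝ) / 2 →
    α * (X.ncard : ℝ) ≤ ((externalNeighborhood G X).ncard : ℝ)

/-!
If `k` is even, then `α > 1`, and a set of half the vertices of a large graph cannot have `α` times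
as many outer neighbours, so there are no large expanders at all (`ExpandsIn.sub_one_mul_card_le`).
Let `k` be odd with smallest prime divisor `p`.

A long path `P`, of small linear length, is found by depth-first search. A vertex of `P` is an *exit*
if it is joined by a short walk outside `P` to a large part `B` of the complement of `P` that is
itself an expander. Since `N(X)` lies in the set of exits, up to a small error, when `X` consists of
the other vertices of `P` and everything they reach outside `P`, expansion forces the proportion of
exits to be at least almost `α / (1 + α)`, which exceeds `1 / p`. With the walks of the exits chosen
so that no vertex is on more than a bounded number of them
(`ExpandsIn.exists_isExitSystem`; this replaces an appeal to Menger's theorem), the deletion of a set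
`F` outside `P` spoils only `O(|F|)` exits, and all other exits can be joined in pairs by short paths
that avoid `F` and meet `P` only in their ends. These properties are recorded in `LinkedPath`.

The rest is combinatorics on `P`. Take `k` disjoint blocks of `P` in which the exits have density
above `1 / p`. In a block choose exits `w < w'` with most exits of the block between them, but many
also beyond `w'`, and join `w` and `w'` by an ear. A path that enters the block at an exit `a` between
`w` and `w'` and is to leave it beyond `w'` can go straight to `w'`, or back to `w` and along the ear
to `w'`. The lengths differ by `2 a + e` with `e` independent of `a`. If the residues realized
so far form a set `R` that is not everything, then two values of `a` for which `R` is invariant under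
translation by `2 a + e` differ by at least `p`, because a smaller difference, doubled, is a unit
modulo `k`. So some exit `a` enlarges `R` (`LinkedPath.exists_reachesResidues`). The choice of the
exit beyond `w'` is left open until the next block is attached; it cannot be spoiled because
there are many candidates. For the same reason a path that starts in the middle of the first block
and passes through the `k - 1` others can finally be closed through an exit before its starting point
(`LinkedPath.exists_isCycle`).
-/

/-! ### Paths inside a vertex set -/

/-- `G` has a path of length `ℓ` from `u` to `v` all of whose vertices lie in `S`. -/
def HasPathIn {V : Type*} (G : SimpleGraph V) (u v : V) (S : Set V) (ℓ : ℕ) : Prop :=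
  ∃ w : G.Walk u v, w.IsPath ∧ (∀ x ∈ w.support, x ∈ S) ∧ w.length = ℓ

namespace HasPathIn

variable {V : Type*} {G : SimpleGraph V} {u v w : V} {S T : Set V} {a b : ℕ}

theorem mono (h : HasPathIn G u v S a) (hST : S ⊆ T) : HasPathIn G u v T a := by
  obtain ⟨q, hq, hS, hl⟩ := h
  exact ⟨q, hq, fun x hx => hST (hS x hx), hl⟩

theorem symm (h : HasPathIn G u v S a) : HasPathIn G v u S a := by
  obtain ⟨q, hq, hS, hl⟩ := h
  exact ⟨q.reverse, hq.reverse, by simpa using hS, by simpa using hl⟩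

theorem length_pos (h : HasPathIn G u v S a) (huv : u ≠ v) : 0 < a := by
  obtain ⟨q, -, -, rfl⟩ := h
  rw [Nat.pos_iff_ne_zero]
  exact fun h0 => huv (SimpleGraph.Walk.eq_of_length_eq_zero h0)

theorem append (h : HasPathIn G u v S a) (h' : HasPathIn G v w T b)
    (hST : ∀ x ∈ S, x ∈ T → x = v) : HasPathIn G u w (S ∪ T) (a + b) := by
  obtain ⟨q, hq, hS, rfl⟩ := h
  obtain ⟨q', hq', hT, rfl⟩ := h'
  refine ⟨q.append q', ?_, ?_, by simp⟩
  · rw [SimpleGraph.Walk.isPath_def, SimpleGraph.Walk.support_append, List.nodup_append']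
    refine ⟨hq.support_nodup, hq'.support_nodup.tail, ?_⟩
    intro x hx hx'
    have hxv := hST x (hS x hx) (hT x (List.mem_of_mem_tail hx'))
    have := hq'.support_nodup
    rw [← SimpleGraph.Walk.cons_tail_support, List.nodup_cons] at this
    exact this.1 (hxv ▸ hx')
  · intro x hx
    rw [SimpleGraph.Walk.mem_support_append_iff] at hx
    exact hx.imp (hS x) (hT x)

/-- Two paths that meet only in their common endpoints close up to a cycle, unless both are the
same edge. -/
theorem exists_isCycle (h : HasPathIn G u v S a) (h' : HasPathIn G v u T b)
    (hST : ∀ x ∈ S, x ∈ T → x = u ∨ x = v) (ha : 1 < a) :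
    ∃ c : G.Walk u u, c.IsCycle ∧ c.length = a + b := by
  obtain ⟨q, hq, hS, rfl⟩ := h
  obtain ⟨q', hq', hT, rfl⟩ := h'
  refine ⟨q.append q', hq.isCycle_append hq' ?_ (Or.inl ha), by simp⟩
  intro x hx hx'
  have h1 := hq.support_nodup
  have h2 := hq'.support_nodup
  rw [← SimpleGraph.Walk.cons_tail_support, List.nodup_cons] at h1 h2
  rcases hST x (hS x (List.mem_of_mem_tail hx)) (hT x (List.mem_of_mem_tail hx')) with rfl | rfl
  · exact h1.1 hx
  · exact h2.1 hx'

/-- A segment of a path that is given by its sequence of vertices. -/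
theorem segment {N : ℕ} {f : ℕ → V} (hinj : Set.InjOn f (Set.Iio N))
    (hadj : ∀ i, i + 1 < N → G.Adj (f i) (f (i + 1))) {i : ℕ} (d : ℕ) (h : i + d < N) :
    HasPathIn G (f i) (f (i + d)) (f '' Set.Icc i (i + d)) d := by
  induction d with
  | zero => exact ⟨.nil, .nil, by simp, rfl⟩
  | succ d ih =>
    have h1 : HasPathIn G (f (i + d)) (f (i + d + 1)) (f '' Set.Icc (i + d) (i + d + 1)) 1 := by
      have hA := hadj (i + d) (by omega)
      refine ⟨hA.toWalk, SimpleGraph.Walk.IsPath.of_adj hA, ?_, by simp⟩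
      intro x hx
      simp only [SimpleGraph.Adj.toWalk, SimpleGraph.Walk.support_cons,
        SimpleGraph.Walk.support_nil, List.mem_cons, List.not_mem_nil, or_false] at hx
      rcases hx with rfl | rfl
      · exact ⟨_, by simp, rfl⟩
      · exact ⟨_, by simp, rfl⟩
    refine ((ih (by omega)).append h1 ?_).mono ?_
    · rintro _ ⟨x, hx, rfl⟩ ⟨y, hy, hxy⟩
      simp only [Set.mem_Icc] at hx hy
      have := hinj (by simp; omega) (by simp; omega) hxy
      congr 1; omega
    · rw [← Set.image_union]
      refine Set.image_mono ?_
      intro x; simp only [Set.mem_union, Set.mem_Icc]; omega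

end HasPathIn

/-! ### Translates of a set of residues -/

/-- A nonempty set of residues that is invariant under adding a unit is everything. -/
theorem Finset.eq_univ_of_image_add_eq {k : ℕ} [NeZero k] {R : Finset (ZMod k)}
    (hR : R.Nonempty) {m : ZMod k} (hm : IsUnit m) (h : R.image (· + m) = R) :
    R = Finset.univ := by
  have hstep : ∀ (j : ℕ), ∀ x ∈ R, x + j * m ∈ R := by
    intro j
    induction j with
    | zero => intro x hx; simpa using hx
    | succ j ih =>
      intro x hx
      rw [← h, Finset.mem_image]
      exact ⟨_, ih x hx, by push_cast; ring⟩
  obtain ⟨x, hx⟩ := hR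
  obtain ⟨u, rfl⟩ := hm
  refine Finset.eq_univ_of_forall fun y => ?_
  have := hstep ((y - x) * ((u⁻¹ : (ZMod k)ˣ) : ZMod k)).val x hx
  simpa [mul_assoc] using this

/-- Among sufficiently many integers of a window of length `L` some `a` has the property that
translation by `2 a + e` moves the set `R`: any two exceptions are at least `k.minFac` apart,
since twice a smaller positive difference is a unit modulo the odd number `k`. -/
theorem exists_image_add_ne {k : ℕ} [NeZero k] (hodd : Odd k) {R : Finset (ZMod k)}
    (hR : R.Nonempty) (hR' : R ≠ Finset.univ) (e : ZMod k) {x L : ℕ} {C : Finset ℕ}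
    (hC : C ⊆ Finset.Ico x (x + L)) (hcard : L + 2 * k.minFac ≤ k.minFac * C.card) :
    ∃ a ∈ C, R.image (· + (2 * (a : ZMod k) + e)) ≠ R := by
  by_contra! hall
  have hp : 0 < k.minFac := Nat.minFac_pos k
  have key : ∀ a ∈ C, ∀ b ∈ C, a < b → b - a < k.minFac → False := by
    intro a ha b hb hab hlt
    refine hR' (Finset.eq_univ_of_image_add_eq hR (m := ((2 * (b - a) : ℕ) : ZMod k)) ?_ ?_)
    · rw [ZMod.isUnit_iff_coprime]
      refine Nat.Coprime.mul_left ?_ ?_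
      · rw [Nat.coprime_two_left]; exact hodd
      · exact (Nat.coprime_of_lt_minFac (by omega) hlt).symm
    · conv_lhs => rw [← hall a ha]
      rw [Finset.image_image]
      conv_rhs => rw [← hall b hb]
      refine Finset.image_congr fun r _ => ?_
      simp only [Function.comp]
      push_cast [Nat.cast_sub hab.le]
      ring
  have hmaps : ∀ a ∈ C, (a - x) / k.minFac ∈ Finset.range (L / k.minFac + 1) := by
    intro a ha
    have := Finset.mem_Ico.1 (hC ha)
    rw [Finset.mem_range, Nat.lt_succ_iff]
    exact Nat.div_le_div_right (by omega)
  have hlt : (Finset.range (L / k.minFac + 1)).card < C.card := by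
    rw [Finset.card_range]
    have h1 := Nat.mul_div_le L k.minFac
    by_contra hcon
    push Not at hcon
    have h2 := Nat.mul_le_mul_left k.minFac hcon
    rw [mul_add] at h2
    omega
  obtain ⟨a, ha, b, hb, hab, heq⟩ := Finset.exists_ne_map_eq_of_card_lt_of_maps_to hlt hmaps
  have ha' := Finset.mem_Ico.1 (hC ha)
  have hb' := Finset.mem_Ico.1 (hC hb)
  have e1 := Nat.div_add_mod (a - x) k.minFac
  have e2 := Nat.div_add_mod (b - x) k.minFac
  have m1 := Nat.mod_lt (a - x) hp
  have m2 := Nat.mod_lt (b - x) hp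
  rw [heq] at e1
  rcases lt_or_gt_of_ne hab with h | h
  · exact key a ha b hb h (by omega)
  · exact key b hb a ha h (by omega)

/-! ### Collecting residues along a linked path -/

/-- A path `f 0, …, f (N - 1)` together with a set `A` of indices of *exits* such that, whenever a
set `F` of at most `m` vertices off the path is deleted, all but fewer than `r` exits remain usable:
any two usable exits are joined by a path whose interior consists of at most `s` vertices and
avoids both `F` and the path `f`. -/
structure LinkedPath {V : Type*} (G : SimpleGraph V) (N : ℕ) (f : ℕ → V) (A : Finset ℕ)
    (r s m : ℕ) : Prop where
  injOn : Set.InjOn f (Set.Iio N)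
  adj : ∀ i, i + 1 < N → G.Adj (f i) (f (i + 1))
  lt : ∀ i ∈ A, i < N
  link : ∀ F : Finset V, F.card ≤ m → (∀ i < N, f i ∉ F) →
    ∃ Good ⊆ A, (A \ Good).card < r ∧ ∀ i ∈ Good, ∀ j ∈ Good, i ≠ j →
      ∃ Q : Finset V, Q.card ≤ s ∧ Disjoint Q F ∧ (∀ l < N, f l ∉ Q) ∧
        ∃ a, HasPathIn G (f i) (f j) (insert (f i) (insert (f j) (Q : Set V))) a

/-- For every `b ∈ T` and every residue `ρ ∈ R` there is a path from `f y` to `f b` inside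
`F ∪ f '' U` whose length is `ρ + b` modulo `k`. Measuring lengths relative to `b` makes the set
`R` independent of the choice of `b`, which is postponed. -/
def ReachesResidues {V : Type*} (G : SimpleGraph V) (f : ℕ → V) (y : ℕ) (F : Finset V)
    (U : Set ℕ) (T : Finset ℕ) {k : ℕ} (R : Finset (ZMod k)) : Prop :=
  ∀ b ∈ T, ∀ ρ ∈ R, ∃ a : ℕ, (a : ZMod k) = ρ + b ∧
    HasPathIn G (f y) (f b) ((F : Set V) ∪ f '' U) a

theorem Finset.exists_card_filter_lt_eq (S : Finset ℕ) {r : ℕ} (h : r < S.card) :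
    ∃ w ∈ S, (S.filter (w < ·)).card = r := by
  induction r generalizing S with
  | zero =>
    have hS : S.Nonempty := Finset.card_pos.1 h
    refine ⟨S.max' hS, S.max'_mem hS, ?_⟩
    rw [Finset.card_eq_zero, Finset.filter_eq_empty_iff]
    exact fun x hx => not_lt.2 (S.le_max' x hx)
  | succ r ih =>
    have hS : S.Nonempty := Finset.card_pos.1 (by omega)
    set M := S.max' hS
    have hM : M ∈ S := S.max'_mem hS
    obtain ⟨w, hw, hc⟩ := ih (S.erase M) (by rw [Finset.card_erase_of_mem hM]; omega)
    rw [Finset.mem_erase] at hw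
    refine ⟨w, hw.2, ?_⟩
    have hlt : w < M := lt_of_le_of_ne (S.le_max' w hw.2) hw.1
    have : S.filter (w < ·) = insert M ((S.erase M).filter (w < ·)) := by
      ext x
      simp only [Finset.mem_filter, Finset.mem_insert, Finset.mem_erase]
      constructor
      · rintro ⟨h1, h2⟩
        by_cases hx : x = M
        · exact Or.inl hx
        · exact Or.inr ⟨⟨hx, h1⟩, h2⟩
      · rintro (rfl | h1)
        · exact ⟨hM, hlt⟩
        · exact ⟨h1.1.2, h1.2⟩
    rw [this, Finset.card_insert_of_notMem (by simp), hc]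

/-- One more block `[x, x + L)` of the path yields at least one more residue, as long as some
residue is missing. An ear joins two exits `w < w'` of the block; a path enters the block at
an exit `a` between them and leaves it beyond `w'`. It can run from `a` directly to `w'`, or back
to `w` and over the ear to `w'`. The choice of `a` makes sure that the difference of the two lengths
does not stabilize the set of residues obtained so far. -/
theorem LinkedPath.exists_reachesResidues {V : Type*} {G : SimpleGraph V} {N : ℕ} {f : ℕ → V}
    {A : Finset ℕ} {r s m : ℕ} (hP : LinkedPath G N f A r s m) {k : ℕ} [NeZero k] (hodd : Odd k)
    {y : ℕ} {F : Finset V} {U : Set ℕ} {T : Finset ℕ} {R : Finset (ZMod k)}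
    (hU : ∀ i ∈ U, i < N) (hF : ∀ i < N, f i ∉ F) (hFc : F.card + 2 * s ≤ m) (hTA : T ⊆ A)
    (hTU : ∀ i ∈ T, i ∈ U) (hTr : r ≤ T.card) (hR : R.Nonempty)
    (hreach : ReachesResidues G f y F U T R) {x L : ℕ} {C : Finset ℕ} (hCA : C ⊆ A)
    (hC : C ⊆ Finset.Ico x (x + L)) (hL : x + L ≤ N) (hdisj : ∀ i ∈ U, i < x)
    (hcard : L + k.minFac * (3 * r + 2) ≤ k.minFac * C.card) :
    ∃ (F' : Finset V) (T' : Finset ℕ) (R' : Finset (ZMod k)), T' ⊆ C ∧ r ≤ T'.card ∧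
      F'.card ≤ F.card + 2 * s ∧ (∀ i < N, f i ∉ F') ∧ R'.Nonempty ∧
      min k (R.card + 1) ≤ R'.card ∧
      ReachesResidues G f y F' (U ∪ Set.Ico x (x + L)) T' R' := by
  classical
  have hp : 0 < k.minFac := Nat.minFac_pos k
  have hCr : 3 * r + 2 ≤ C.card := by
    by_contra hcon
    push Not at hcon
    have := (Nat.mul_lt_mul_left hp).2 hcon
    omega
  -- the ear
  obtain ⟨Good₁, -, hGood₁, hlink₁⟩ := hP.link F (by omega) hF
  set G₁ := C ∩ Good₁ with hG₁
  have hG₁c : C.card < G₁.card + r := by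
    have h1 : (C \ Good₁).card < r :=
      (Finset.card_le_card (Finset.sdiff_subset_sdiff hCA le_rfl)).trans_lt hGood₁
    have h2 := Finset.card_inter_add_card_sdiff C Good₁
    rw [← hG₁] at h2
    omega
  obtain ⟨w', hw', hw'c⟩ := G₁.exists_card_filter_lt_eq (r := r) (by omega)
  have hne : G₁.Nonempty := ⟨w', hw'⟩
  set w := G₁.min' hne with hw
  have hwG : w ∈ G₁ := G₁.min'_mem hne
  set D := G₁.filter (fun a => w < a ∧ a < w') with hD
  have hDc : G₁.card ≤ D.card + r + 2 := by
    have hsub : G₁ ⊆ ({w, w'} ∪ G₁.filter (w' < ·)) ∪ D := by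
      intro a ha
      have := G₁.min'_le a ha
      simp only [hD, Finset.mem_union, Finset.mem_insert, Finset.mem_singleton,
        Finset.mem_filter, ha, true_and]
      omega
    have h1 := Finset.card_le_card hsub
    have h2 := Finset.card_union_le ({w, w'} ∪ G₁.filter (w' < ·)) D
    have h3 := Finset.card_union_le {w, w'} (G₁.filter (w' < ·))
    have h4 : ({w, w'} : Finset ℕ).card ≤ 2 := Finset.card_le_two
    omega
  have hww' : w < w' := by
    refine lt_of_le_of_ne (G₁.min'_le w' hw') fun heq => ?_
    have hsub : G₁ ⊆ insert w' (G₁.filter (w' < ·)) := by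
      intro a ha
      have := G₁.min'_le a ha
      simp only [Finset.mem_insert, Finset.mem_filter, ha, true_and]
      omega
    have h1 := Finset.card_le_card hsub
    have h2 := Finset.card_insert_le w' (G₁.filter (w' < ·))
    omega
  obtain ⟨Q₁, hQ₁c, hQ₁F, hQ₁P, e, he⟩ := hlink₁ w (Finset.mem_inter.1 hwG).2 w'
    (Finset.mem_inter.1 hw').2 hww'.ne
  -- the link from the previous block
  have hF₁ : ∀ i < N, f i ∉ F ∪ Q₁ := fun i hi hmem =>
    (Finset.mem_union.1 hmem).elim (hF i hi) (hQ₁P i hi)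
  have hF₁c : (F ∪ Q₁).card ≤ F.card + s := (Finset.card_union_le _ _).trans (by omega)
  obtain ⟨Good₂, -, hGood₂, hlink₂⟩ := hP.link (F ∪ Q₁) (by omega) hF₁
  obtain ⟨b, hb⟩ : (T ∩ Good₂).Nonempty := by
    rw [← Finset.card_pos]
    have h1 : (T \ Good₂).card < r :=
      (Finset.card_le_card (Finset.sdiff_subset_sdiff hTA le_rfl)).trans_lt hGood₂
    have h2 := Finset.card_inter_add_card_sdiff T Good₂
    omega
  rw [Finset.mem_inter] at hb
  have hDC : D ⊆ C := (Finset.filter_subset _ _).trans Finset.inter_subset_left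
  have hDc₂ : C.card ≤ (D ∩ Good₂).card + 3 * r := by
    have h1 : (D \ Good₂).card < r :=
      (Finset.card_le_card (Finset.sdiff_subset_sdiff (hDC.trans hCA) le_rfl)).trans_lt hGood₂
    have h2 := Finset.card_inter_add_card_sdiff D Good₂
    omega
  obtain ⟨a, haD, ha⟩ : ∃ a ∈ D ∩ Good₂, R ≠ Finset.univ →
      R.image (· + (2 * (a : ZMod k) + ((e : ZMod k) - w - w'))) ≠ R := by
    by_cases hRu : R = Finset.univ
    · obtain ⟨a, ha⟩ : (D ∩ Good₂).Nonempty := Finset.card_pos.1 (by omega)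
      exact ⟨a, ha, fun h => absurd hRu h⟩
    · obtain ⟨a, ha, h⟩ := exists_image_add_ne hodd hR hRu ((e : ZMod k) - w - w')
        (x := x) (L := L) (C := D ∩ Good₂) (Finset.inter_subset_left.trans (hDC.trans hC)) (by
          have h1 := Nat.mul_le_mul_left k.minFac hDc₂
          rw [mul_add] at h1 hcard
          linarith)
      exact ⟨a, ha, fun _ => h⟩
  rw [Finset.mem_inter, hD, Finset.mem_filter] at haD
  obtain ⟨⟨haG₁, hwa, haw'⟩, haGood⟩ := haD
  have hmemI : ∀ i ∈ G₁, x ≤ i ∧ i < x + L := fun i hi =>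
    Finset.mem_Ico.1 (hC (Finset.mem_inter.1 hi).1)
  have hbx : b < x := hdisj b (hTU b hb.1)
  obtain ⟨Q₂, hQ₂c, hQ₂F, hQ₂P, q, hq⟩ := hlink₂ b hb.2 a haGood
    (by have := hmemI a haG₁; omega)
  have hwI := hmemI w hwG
  have hw'I := hmemI w' hw'
  have hf : ∀ i < N, ∀ j < N, f i = f j → i = j := fun i hi j hj h => hP.injOn hi hj h
  have hQQ : ∀ z ∈ Q₂, z ∉ F ∧ z ∉ Q₁ := by
    intro z hz
    have := Finset.disjoint_left.1 hQ₂F hz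
    simpa [not_or] using this
  refine ⟨F ∪ Q₁ ∪ Q₂, G₁.filter (w' < ·),
    R.image (· + ((b : ZMod k) + q - a)) ∪ R.image (· + ((b : ZMod k) + q + a - w + e - w')),
    (Finset.filter_subset _ _).trans Finset.inter_subset_left, hw'c.ge,
    (Finset.card_union_le _ _).trans (by omega), ?_, ?_, ?_, ?_⟩
  · exact fun i hi hmem => (Finset.mem_union.1 hmem).elim (hF₁ i hi) (hQ₂P i hi)
  · exact (hR.image _).mono Finset.subset_union_left
  · have hc : ∀ c : ZMod k, (R.image (· + c)).card = R.card := fun c =>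
      Finset.card_image_of_injective _ (add_left_injective c)
    by_cases hRu : R = Finset.univ
    · refine (min_le_left _ _).trans ?_
      refine le_trans (le_of_eq ?_) (Finset.card_le_card Finset.subset_union_left)
      rw [hc, hRu, Finset.card_univ, ZMod.card]
    · refine (min_le_right _ _).trans ?_
      rw [← hc ((b : ZMod k) + q - a), Nat.succ_le_iff]
      refine Finset.card_lt_card (Finset.ssubset_iff_subset_ne.2
        ⟨Finset.subset_union_left, fun heq => ha hRu ?_⟩)
      have h1 : R.image (· + ((b : ZMod k) + q + a - w + e - w')) =
          R.image (· + ((b : ZMod k) + q - a)) := by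
        refine Finset.eq_of_subset_of_card_le ?_ (by rw [hc, hc])
        rw [heq]; exact Finset.subset_union_right
      have h2 := congrArg (Finset.image (· + -((b : ZMod k) + q - a))) h1
      rw [Finset.image_image, Finset.image_image] at h2
      calc _ = _ := Finset.image_congr fun z _ => by simp only [Function.comp]; ring
        _ = _ := h2
        _ = R.image id := Finset.image_congr fun z _ => by simp only [Function.comp, id]; ring
        _ = R := Finset.image_id
  · intro b' hb' ρ' hρ'
    rw [Finset.mem_filter] at hb'
    have hb'I := hmemI b' hb'.1
    -- from `y` through the previous blocks and the link to the exit `a`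
    have hstart : ∀ ρ ∈ R, ∃ l : ℕ, (l : ZMod k) = ρ + b + q ∧
        HasPathIn G (f y) (f a) (((F : Set V) ∪ f '' U) ∪
          insert (f b) (insert (f a) (Q₂ : Set V))) l := by
      intro ρ hρ
      obtain ⟨l, hl, hpath⟩ := hreach b hb.1 ρ hρ
      refine ⟨l + q, by push_cast; rw [hl], hpath.append hq ?_⟩
      rintro z hz (rfl | rfl | hz')
      · rfl
      · rcases hz with hz | ⟨i, hi, hia⟩
        · exact absurd hz (hF a (by omega))
        · have := hf i (hU i hi) a (by omega) hia
          have := hdisj i hi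
          omega
      · rcases hz with hz | ⟨i, hi, rfl⟩
        · exact absurd hz (hQQ z hz').1
        · exact absurd hz' (hQ₂P i (hU i hi))
    -- the starting part meets neither the ear nor the block, except in `a`
    have hsep : ∀ i, x ≤ i → i < x + L → f i ∈ ((F : Set V) ∪ f '' U) ∪
        insert (f b) (insert (f a) (Q₂ : Set V)) → f i = f a := by
      rintro i hi hi' ((h | ⟨j, hj, hji⟩) | h | h | h)
      · exact absurd h (hF i (by omega))
      · have := hf j (hU j hj) i (by omega) hji
        have := hdisj j hj
        omega
      · have := hf i (by omega) b (by omega) h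
        omega
      · exact h
      · exact absurd h (hQ₂P i (by omega))
    have hsepQ : ∀ z ∈ Q₁, z ∉ ((F : Set V) ∪ f '' U) ∪
        insert (f b) (insert (f a) (Q₂ : Set V)) := by
      rintro z hz ((h | ⟨j, hj, rfl⟩) | rfl | rfl | h)
      · exact Finset.disjoint_left.1 hQ₁F hz h
      · exact hQ₁P j (hU j hj) hz
      · exact hQ₁P b (by omega) hz
      · exact hQ₁P a (by omega) hz
      · exact (hQQ z h).2 hz
    have hbI : f b ∈ f '' U := ⟨b, hTU b hb.1, rfl⟩
    have hIm : ∀ i, x ≤ i → i < x + L → f i ∈ f '' (U ∪ Set.Ico x (x + L)) := fun i h h' =>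
      ⟨i, Or.inr ⟨h, h'⟩, rfl⟩
    have hUm : f '' U ⊆ f '' (U ∪ Set.Ico x (x + L)) := Set.image_mono Set.subset_union_left
    have hbig : ((F : Set V) ∪ f '' U) ∪ insert (f b) (insert (f a) (Q₂ : Set V)) ⊆
        ((F ∪ Q₁ ∪ Q₂ : Finset V) : Set V) ∪ f '' (U ∪ Set.Ico x (x + L)) := by
      rintro z ((h | h) | rfl | rfl | h)
      · left; simp only [Finset.coe_union]; exact Or.inl (Or.inl h)
      · right; exact hUm h
      · right; exact hUm hbI
      · right; exact hIm a (by omega) (by omega)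
      · left; simp only [Finset.coe_union]; exact Or.inr h
    have hIcc : ∀ i j, x ≤ i → j < x + L → f '' Set.Icc i j ⊆
        ((F ∪ Q₁ ∪ Q₂ : Finset V) : Set V) ∪ f '' (U ∪ Set.Ico x (x + L)) := by
      rintro i j hi hj z ⟨l, hl, rfl⟩
      rw [Set.mem_Icc] at hl
      exact Or.inr (hIm l (by omega) (by omega))
    rcases Finset.mem_union.1 hρ' with h | h
    · obtain ⟨ρ, hρ, rfl⟩ := Finset.mem_image.1 h
      obtain ⟨l, hl, hpath⟩ := hstart ρ hρ
      have hseg := HasPathIn.segment hP.injOn hP.adj (i := a) (b' - a) (by omega)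
      rw [show a + (b' - a) = b' by omega] at hseg
      refine ⟨l + (b' - a), ?_, (hpath.append hseg ?_).mono
        (Set.union_subset hbig (hIcc _ _ (by omega) (by omega)))⟩
      · push_cast [Nat.cast_sub (show a ≤ b' by omega)]
        rw [hl]; ring
      · rintro _ hz ⟨i, hi, rfl⟩
        rw [Set.mem_Icc] at hi
        exact hsep i (by omega) (by omega) hz
    · obtain ⟨ρ, hρ, rfl⟩ := Finset.mem_image.1 h
      obtain ⟨l, hl, hpath⟩ := hstart ρ hρ
      have hback := HasPathIn.segment hP.injOn hP.adj (i := w) (a - w) (by omega)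
      rw [show w + (a - w) = a by omega] at hback
      have hseg := HasPathIn.segment hP.injOn hP.adj (i := w') (b' - w') (by omega)
      rw [show w' + (b' - w') = b' by omega] at hseg
      have hear := he.append hseg (by
        rintro _ hz ⟨i, hi, rfl⟩
        rw [Set.mem_Icc] at hi
        rcases hz with h | h | h
        · have := hf i (by omega) w (by omega) h
          omega
        · exact h
        · exact absurd h (hQ₁P i (by omega)))
      have hgad := hback.symm.append hear (by
        rintro _ ⟨i, hi, rfl⟩ hz
        rw [Set.mem_Icc] at hi
        rcases hz with (h | h | h) | ⟨j, hj, hji⟩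
        · exact h
        · have := hf i (by omega) w' (by omega) h
          omega
        · exact absurd h (hQ₁P i (by omega))
        · rw [Set.mem_Icc] at hj
          have := hf j (by omega) i (by omega) hji
          omega)
      refine ⟨l + ((a - w) + (e + (b' - w'))), ?_, (hpath.append hgad ?_).mono
        (Set.union_subset hbig (Set.union_subset (hIcc _ _ (by omega) (by omega))
          (Set.union_subset ?_ (hIcc _ _ (by omega) (by omega)))))⟩
      · push_cast [Nat.cast_sub hwa.le, Nat.cast_sub hb'.2.le]
        rw [hl]; ring
      · rintro z hz (⟨i, hi, rfl⟩ | (rfl | rfl | h) | ⟨i, hi, rfl⟩)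
        · rw [Set.mem_Icc] at hi
          exact hsep i (by omega) (by omega) hz
        · exact hsep w (by omega) (by omega) hz
        · exact hsep w' (by omega) (by omega) hz
        · exact absurd hz (hsepQ z h)
        · rw [Set.mem_Icc] at hi
          exact hsep i (by omega) (by omega) hz
      · rintro z (rfl | rfl | h)
        · exact Or.inr (hIm w (by omega) (by omega))
        · exact Or.inr (hIm w' (by omega) (by omega))
        · left; simp only [Finset.coe_union]; exact Or.inl (Or.inr h)

/-- A linked path that contains `k` disjoint blocks in which the exits have density
slightly above `1 / k.minFac` gives rise to cycles of all lengths modulo the odd number `k`. -/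
theorem LinkedPath.exists_isCycle {V : Type*} {G : SimpleGraph V} {N : ℕ} {f : ℕ → V}
    {A : Finset ℕ} {r s k : ℕ} (hP : LinkedPath G N f A r s (2 * k * s)) (hk : 1 < k)
    (hodd : Odd k) (x : ℕ → ℕ) (L : ℕ) (hx : ∀ j < k, x j + L ≤ N)
    (hdisj : ∀ j, j + 1 < k → x j + L ≤ x (j + 1))
    (hcard : ∀ j < k, L + k.minFac * (3 * r + 2) ≤
      k.minFac * (A.filter (· ∈ Finset.Ico (x j) (x j + L))).card) (t : ℕ) :
    ∃ (v : V) (c : G.Walk v v), c.IsCycle ∧ c.length ≡ t [MOD k] := by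
  classical
  have : NeZero k := ⟨by omega⟩
  have hp : 0 < k.minFac := Nat.minFac_pos k
  set C : ℕ → Finset ℕ := fun j => A.filter (· ∈ Finset.Ico (x j) (x j + L)) with hCdef
  have hC : ∀ j, ∀ i ∈ C j, x j ≤ i ∧ i < x j + L := fun j i hi =>
    Finset.mem_Ico.1 (Finset.mem_filter.1 hi).2
  have hC₀ : 3 * r + 2 ≤ (C 0).card := by
    by_contra hcon
    push Not at hcon
    have := (Nat.mul_lt_mul_left hp).2 hcon
    have := hcard 0 (by omega)
    simp only [hCdef] at *
    omega
  obtain ⟨y, hy, hyc⟩ := (C 0).exists_card_filter_lt_eq (r := r) (by omega)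
  have hyI := hC 0 y hy
  have hlow : r ≤ ((C 0).filter (· < y)).card := by
    have hsub : C 0 ⊆ insert y ((C 0).filter (y < ·) ∪ (C 0).filter (· < y)) := by
      intro a ha
      simp only [Finset.mem_insert, Finset.mem_union, Finset.mem_filter, ha, true_and]
      omega
    have h1 := Finset.card_le_card hsub
    have h2 := Finset.card_insert_le y ((C 0).filter (y < ·) ∪ (C 0).filter (· < y))
    have h3 := Finset.card_union_le ((C 0).filter (y < ·)) ((C 0).filter (· < y))
    omega
  have hx₀ : ∀ i < k, x 0 ≤ x i := by
    intro i
    induction i with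
    | zero => intro _; rfl
    | succ i ih => intro hi; have := ih (by omega); have := hdisj i hi; omega
  have main : ∀ i < k, ∃ (F : Finset V) (T : Finset ℕ) (R : Finset (ZMod k)), T ⊆ C i ∧
      (∀ b ∈ T, y < b) ∧ r ≤ T.card ∧ F.card ≤ 2 * i * s ∧ (∀ j < N, f j ∉ F) ∧ R.Nonempty ∧
      min k (i + 1) ≤ R.card ∧ ReachesResidues G f y F (Set.Ico y (x i + L)) T R := by
    intro i
    induction i with
    | zero =>
      intro hi
      refine ⟨∅, (C 0).filter (y < ·), {-(y : ZMod k)}, Finset.filter_subset _ _,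
        fun b hb => (Finset.mem_filter.1 hb).2, hyc.ge, by simp, by simp, by simp, by simp, ?_⟩
      intro b hb ρ hρ
      rw [Finset.mem_filter] at hb
      rw [Finset.mem_singleton] at hρ
      have hbI := hC 0 b hb.1
      have := hx 0 (by omega)
      have hseg := HasPathIn.segment hP.injOn hP.adj (i := y) (b - y) (by omega)
      rw [show y + (b - y) = b by omega] at hseg
      refine ⟨b - y, ?_, hseg.mono ?_⟩
      · rw [hρ, Nat.cast_sub hb.2.le]; ring
      · refine (Set.image_mono ?_).trans Set.subset_union_right
        intro j; simp only [Set.mem_Icc, Set.mem_Ico]; omega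
    | succ i ih =>
      intro hi
      obtain ⟨F, T, R, hT, hTy, hTr, hFc, hF, hR, hRc, hreach⟩ := ih (by omega)
      have hd := hdisj i hi
      have hxi := hx i (by omega)
      have hx0 := hx₀ i (by omega)
      have hms : 2 * i * s + 2 * s ≤ 2 * k * s := by
        rw [show 2 * i * s + 2 * s = 2 * (i + 1) * s by ring]
        exact Nat.mul_le_mul_right _ (by omega)
      obtain ⟨F', T', R', hT', hTr', hFc', hF', hR', hRc', hreach'⟩ :=
        hP.exists_reachesResidues hodd (U := Set.Ico y (x i + L)) (C := C (i + 1))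
          (fun j hj => by simp only [Set.mem_Ico] at hj; omega) hF (by omega)
          (hT.trans (Finset.filter_subset _ _))
          (fun j hj => ⟨(hTy j hj).le, (hC i j (hT hj)).2⟩) hTr hR hreach
          (Finset.filter_subset _ _) (fun j hj => (Finset.mem_filter.1 hj).2) (hx (i + 1) hi)
          (fun j hj => by simp only [Set.mem_Ico] at hj; omega) (hcard (i + 1) hi)
      refine ⟨F', T', R', hT', ?_, hTr', hFc'.trans ?_, hF', hR', ?_, ?_⟩
      · intro b hb
        have := hC _ b (hT' hb)
        omega
      · rw [show 2 * (i + 1) * s = 2 * i * s + 2 * s by ring]; omega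
      · refine le_trans ?_ hRc'
        omega
      · intro b hb ρ hρ
        obtain ⟨l, hl, hpath⟩ := hreach' b hb ρ hρ
        refine ⟨l, hl, hpath.mono (Set.union_subset_union_right _ (Set.image_mono ?_))⟩
        rintro j (hj | hj) <;> simp only [Set.mem_Ico] at hj ⊢ <;> omega
  obtain ⟨F, T, R, hT, hTy, hTr, hFc, hF, hR, hRc, hreach⟩ := main (k - 1) (by omega)
  have hRu : R = Finset.univ := by
    rw [← Finset.card_eq_iff_eq_univ, ZMod.card]
    have h1 : R.card ≤ k := by
      have := Finset.card_le_univ R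
      rwa [ZMod.card] at this
    omega
  obtain ⟨Good, -, hGood, hlink⟩ := hP.link F
    (hFc.trans (Nat.mul_le_mul_right _ (by omega))) hF
  have pick : ∀ S ⊆ A, r ≤ S.card → ∃ i ∈ S, i ∈ Good := by
    intro S hS hr
    have h1 : (S \ Good).card < r :=
      (Finset.card_le_card (Finset.sdiff_subset_sdiff hS le_rfl)).trans_lt hGood
    have h2 := Finset.card_inter_add_card_sdiff S Good
    obtain ⟨i, hi⟩ : (S ∩ Good).Nonempty := Finset.card_pos.1 (by omega)
    exact ⟨i, (Finset.mem_inter.1 hi).1, (Finset.mem_inter.1 hi).2⟩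
  obtain ⟨b, hbT, hbG⟩ := pick T (hT.trans (Finset.filter_subset _ _)) hTr
  obtain ⟨c, hcT, hcG⟩ := pick ((C 0).filter (· < y))
    ((Finset.filter_subset _ _).trans (Finset.filter_subset _ _)) hlow
  rw [Finset.mem_filter] at hcT
  have hcI := hC 0 c hcT.1
  have hyb := hTy b hbT
  have hbI := hC _ b (hT hbT)
  have hxk := hx (k - 1) (by omega)
  have hx0 := hx 0 (by omega)
  obtain ⟨Q, -, hQF, hQP, q, hq⟩ := hlink b hbG c hcG (by omega)
  have hf : ∀ i < N, ∀ j < N, f i = f j → i = j := fun i hi j hj h => hP.injOn hi hj h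
  obtain ⟨l, hl, hpath⟩ := hreach b hbT ((t : ZMod k) - b - q - (y - c)) (by simp [hRu])
  have hseg := HasPathIn.segment hP.injOn hP.adj (i := c) (y - c) (by omega)
  rw [show c + (y - c) = y by omega] at hseg
  have hlq := hpath.append hq (by
    rintro z hz (rfl | rfl | hz')
    · rfl
    · rcases hz with hz | ⟨i, hi, hia⟩
      · exact absurd hz (hF c (by omega))
      · rw [Set.mem_Ico] at hi
        have := hf i (by omega) c (by omega) hia
        omega
    · rcases hz with hz | ⟨i, hi, rfl⟩
      · exact absurd hz (Finset.disjoint_left.1 hQF hz')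
      · rw [Set.mem_Ico] at hi
        exact absurd hz' (hQP i (by omega)))
  have hl₀ : 0 < l := hpath.length_pos fun h => by
    have := hf y (by omega) b (by omega) h
    omega
  have hq₀ : 0 < q := hq.length_pos fun h => by
    have := hf b (by omega) c (by omega) h
    omega
  obtain ⟨cyc, hcyc, hlen⟩ := hlq.exists_isCycle hseg (by
    rintro z hz ⟨i, hi, rfl⟩
    rw [Set.mem_Icc] at hi
    rcases hz with (h | ⟨j, hj, hji⟩) | h | h | h
    · exact absurd h (hF i (by omega))
    · rw [Set.mem_Ico] at hj
      have := hf j (by omega) i (by omega) hji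
      left; congr 1; omega
    · have := hf i (by omega) b (by omega) h
      omega
    · exact Or.inr h
    · exact absurd h (hQP i (by omega))) (by omega)
  refine ⟨_, cyc, hcyc, ?_⟩
  rw [← ZMod.natCast_eq_natCast_iff, hlen]
  push_cast [Nat.cast_sub hcT.2.le]
  rw [hl]; ring

/-! ### Expansion inside a vertex set -/

section Expansion

variable {V : Type*} [Fintype V] [DecidableEq V] (G : SimpleGraph V) [DecidableRel G.Adj]

/-- The external neighbourhood of a finite set of vertices, as a `Finset`. -/
def SimpleGraph.outerBoundary (X : Finset V) : Finset V :=
  {v | v ∉ X ∧ ∃ u ∈ X, G.Adj u v}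

/-- The subgraph of `G` induced on `W` is `γ`-expanding. -/
def ExpandsIn (W : Finset V) (γ : ℝ) : Prop :=
  ∀ Y ⊆ W, 2 * Y.card ≤ W.card → γ * Y.card ≤ ((G.outerBoundary Y ∩ W).card : ℝ)

/-- The vertices that can be reached from `Y` in at most `j` steps, each of which ends in `W`. -/
def reachWithin (W Y : Finset V) : ℕ → Finset V
  | 0 => Y
  | j + 1 => reachWithin W Y j ∪ (G.outerBoundary (reachWithin W Y j) ∩ W)

variable {G}

theorem SimpleGraph.mem_outerBoundary {X : Finset V} {v : V} :
    v ∈ G.outerBoundary X ↔ v ∉ X ∧ ∃ u ∈ X, G.Adj u v := by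
  simp [SimpleGraph.outerBoundary]

theorem subset_reachWithin (W Y : Finset V) (j : ℕ) : Y ⊆ reachWithin G W Y j := by
  induction j with
  | zero => exact subset_rfl
  | succ j ih => exact ih.trans Finset.subset_union_left

theorem reachWithin_subset (W Y : Finset V) (j : ℕ) : reachWithin G W Y j ⊆ Y ∪ W := by
  induction j with
  | zero => exact Finset.subset_union_left
  | succ j ih =>
    exact Finset.union_subset ih (Finset.inter_subset_right.trans Finset.subset_union_right)

theorem card_reachWithin_succ (W Y : Finset V) (j : ℕ) :
    (reachWithin G W Y (j + 1)).card =
      (reachWithin G W Y j).card + (G.outerBoundary (reachWithin G W Y j) ∩ W).card := by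
  refine Finset.card_union_of_disjoint (Finset.disjoint_left.2 fun v hv hv' => ?_)
  exact (SimpleGraph.mem_outerBoundary.1 (Finset.mem_inter.1 hv').1).1 hv

theorem exists_walk_of_mem_reachWithin {W Y : Finset V} {j : ℕ} {v : V}
    (hv : v ∈ reachWithin G W Y j) :
    ∃ u ∈ Y, ∃ w : G.Walk u v, w.length ≤ j ∧ ∀ x ∈ w.support.tail, x ∈ W := by
  induction j generalizing v with
  | zero => exact ⟨v, hv, .nil, le_rfl, by simp⟩
  | succ j ih =>
    rcases Finset.mem_union.1 hv with hv | hv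
    · obtain ⟨u, hu, w, hw, hW⟩ := ih hv
      exact ⟨u, hu, w, hw.trans (Nat.le_succ j), hW⟩
    · rw [Finset.mem_inter, SimpleGraph.mem_outerBoundary] at hv
      obtain ⟨⟨-, x, hx, hxv⟩, hvW⟩ := hv
      obtain ⟨u, hu, w, hw, hW⟩ := ih hx
      refine ⟨u, hu, w.concat hxv, by simpa using hw, ?_⟩
      intro z hz
      rw [SimpleGraph.Walk.support_concat,
        List.tail_append_of_ne_nil (by simp), List.mem_append, List.mem_singleton] at hz
      rcases hz with hz | rfl
      · exact hW z hz
      · exact hvW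

/-- After deletion of a small set `F` an expander contains an expander that misses only `O(|F|)`
vertices: remove a largest badly expanding set. -/
theorem ExpandsIn.exists_core {W : Finset V} {β : ℝ} (h : ExpandsIn G W (2 * β)) (hβ : 0 < β)
    {F : Finset V} (hF : F.card * (2 + 1 / β) ≤ β / 2 * W.card) :
    ∃ W' ⊆ W \ F, ((W \ W').card : ℝ) ≤ F.card * (1 + 1 / β) ∧ ExpandsIn G W' β := by
  set S : Finset (Finset V) := W.powerset.filter fun X => X ⊆ W \ F ∧ 2 * X.card ≤ W.card ∧
    ((G.outerBoundary X ∩ (W \ F)).card : ℝ) ≤ β * X.card with hS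
  have hne : S.Nonempty := by
    refine ⟨∅, ?_⟩
    rw [hS, Finset.mem_filter]
    simp [SimpleGraph.outerBoundary]
  obtain ⟨X, hXS, hmax⟩ := S.exists_max_image Finset.card hne
  have hXS' := hXS
  rw [hS, Finset.mem_filter] at hXS'
  obtain ⟨-, hXWF, hXW, hXb⟩ := hXS'
  have hXsub : X ⊆ W := hXWF.trans Finset.sdiff_subset
  have hXF : (X.card : ℝ) ≤ F.card * (1 / β) := by
    have h1 := h X hXsub hXW
    have h2 : G.outerBoundary X ∩ W ⊆ (G.outerBoundary X ∩ (W \ F)) ∪ F := by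
      intro v hv
      simp only [Finset.mem_inter, Finset.mem_union, Finset.mem_sdiff] at hv ⊢
      tauto
    have h3 : ((G.outerBoundary X ∩ W).card : ℝ) ≤
        (G.outerBoundary X ∩ (W \ F)).card + F.card := by
      exact_mod_cast (Finset.card_le_card h2).trans (Finset.card_union_le _ _)
    rw [mul_one_div, le_div_iff₀ hβ]
    linarith
  have hFX : ((F.card + X.card : ℕ) : ℝ) ≤ F.card * (1 + 1 / β) := by
    push_cast; linarith
  have hcompl : W \ ((W \ F) \ X) ⊆ F ∪ X := by
    intro v hv
    simp only [Finset.mem_sdiff, Finset.mem_union] at hv ⊢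
    tauto
  refine ⟨(W \ F) \ X, Finset.sdiff_subset, ?_, ?_⟩
  · refine le_trans ?_ hFX
    exact_mod_cast (Finset.card_le_card hcompl).trans (Finset.card_union_le _ _)
  intro Y hY hYc
  by_contra! hcon
  have hYWF : Y ⊆ W \ F := hY.trans Finset.sdiff_subset
  have hYW : Y ⊆ W := hYWF.trans Finset.sdiff_subset
  have hdisj : Disjoint X Y :=
    Finset.disjoint_left.2 fun v hv hv' => (Finset.mem_sdiff.1 (hY hv')).2 hv
  have hYpos : 0 < Y.card := by
    rw [Nat.pos_iff_ne_zero]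
    intro h0
    rw [h0] at hcon
    have : (0 : ℝ) ≤ ((G.outerBoundary Y ∩ ((W \ F) \ X)).card : ℝ) := by positivity
    simp at hcon
    linarith
  have hunion : (X ∪ Y).card = X.card + Y.card := Finset.card_union_of_disjoint hdisj
  by_cases hsmall : 2 * (X ∪ Y).card ≤ W.card
  · have hmem : X ∪ Y ∈ S := by
      rw [hS, Finset.mem_filter, Finset.mem_powerset]
      refine ⟨Finset.union_subset hXsub hYW, Finset.union_subset hXWF hYWF, hsmall, ?_⟩
      have h1 : G.outerBoundary (X ∪ Y) ∩ (W \ F) ⊆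
          (G.outerBoundary X ∩ (W \ F)) ∪ (G.outerBoundary Y ∩ ((W \ F) \ X)) := by
        intro v hv
        simp only [Finset.mem_inter, Finset.mem_union, Finset.mem_sdiff,
          SimpleGraph.mem_outerBoundary, not_or] at hv ⊢
        obtain ⟨⟨⟨hvX, hvY⟩, u, hu, huv⟩, hvW⟩ := hv
        rcases hu with hu | hu
        · exact Or.inl ⟨⟨hvX, u, hu, huv⟩, hvW⟩
        · exact Or.inr ⟨⟨hvY, u, hu, huv⟩, hvW, hvX⟩
      have h2 : ((G.outerBoundary (X ∪ Y) ∩ (W \ F)).card : ℝ) ≤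
          (G.outerBoundary X ∩ (W \ F)).card + (G.outerBoundary Y ∩ ((W \ F) \ X)).card := by
        exact_mod_cast (Finset.card_le_card h1).trans (Finset.card_union_le _ _)
      rw [hunion]
      push_cast
      linarith
    have := hmax _ hmem
    omega
  · have hYc' : 2 * Y.card ≤ W.card := hYc.trans
      (Finset.card_le_card (Finset.sdiff_subset.trans Finset.sdiff_subset))
    have h1 := h Y hYW hYc'
    have h2 : G.outerBoundary Y ∩ W ⊆ (G.outerBoundary Y ∩ ((W \ F) \ X)) ∪ (F ∪ X) := by
      intro v hv
      simp only [Finset.mem_inter, Finset.mem_union, Finset.mem_sdiff] at hv ⊢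
      tauto
    have h3 : ((G.outerBoundary Y ∩ W).card : ℝ) ≤
        (G.outerBoundary Y ∩ ((W \ F) \ X)).card + (F.card + X.card) := by
      have h4 := (Finset.card_le_card h2).trans (Finset.card_union_le _ _)
      have h5 := Finset.card_union_le F X
      exact_mod_cast h4.trans (by omega)
    have h6 : (W.card : ℝ) < 2 * (X.card + Y.card) := by
      rw [hunion] at hsmall
      exact_mod_cast not_le.1 hsmall
    have h7 : β * Y.card < F.card + X.card := by linarith
    have h8 : β * X.card ≤ F.card := by
      rw [mul_one_div, le_div_iff₀ hβ] at hXF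
      linarith
    have h9 : β * W.card < 2 * (β * X.card + β * Y.card) := by nlinarith
    have h10 : (F.card : ℝ) * (2 + 1 / β) = 2 * F.card + F.card * (1 / β) := by ring
    linarith

/-- In an expander any two vertices are joined by a walk of logarithmic length. -/
theorem ExpandsIn.exists_walk {W : Finset V} {γ : ℝ} (h : ExpandsIn G W γ) (hγ : 0 < γ) {m : ℕ}
    (hm : (W.card : ℝ) < (1 + γ) ^ m) {u v : V} (hu : u ∈ W) (hv : v ∈ W) :
    ∃ w : G.Walk u v, w.length ≤ 2 * m ∧ ∀ x ∈ w.support, x ∈ W := by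
  have hbig : ∀ x ∈ W, W.card < 2 * (reachWithin G W {x} m).card := by
    intro x hx
    have hsub : ∀ j, reachWithin G W {x} j ⊆ W := fun j =>
      (reachWithin_subset W {x} j).trans (by simpa [Finset.insert_subset_iff] using hx)
    have hgrow : ∀ j ≤ m, W.card < 2 * (reachWithin G W {x} j).card ∨
        (1 + γ) ^ j ≤ ((reachWithin G W {x} j).card : ℝ) := by
      intro j
      induction j with
      | zero => intro _; right; simp [reachWithin]
      | succ j ih =>
        intro hj
        have hc := card_reachWithin_succ (G := G) W {x} j
        by_cases hlt : W.card < 2 * (reachWithin G W {x} j).card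
        · left; omega
        · right
          have h1 := (ih (by omega)).resolve_left hlt
          have h2 := h _ (hsub j) (not_lt.1 hlt)
          rw [hc, pow_succ]
          push_cast
          nlinarith
    rcases hgrow m le_rfl with h1 | h1
    · exact h1
    · have h2 : ((reachWithin G W {x} m).card : ℝ) ≤ W.card := by
        exact_mod_cast Finset.card_le_card (hsub m)
      linarith
  have hwalk : ∀ x ∈ W, ∀ z ∈ reachWithin G W {x} m,
      ∃ w : G.Walk x z, w.length ≤ m ∧ ∀ y ∈ w.support, y ∈ W := by
    intro x hx z hz
    obtain ⟨x', hx', w, hw, hW⟩ := exists_walk_of_mem_reachWithin hz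
    obtain rfl := Finset.mem_singleton.1 hx'
    refine ⟨w, hw, fun y hy => ?_⟩
    rw [← SimpleGraph.Walk.cons_tail_support, List.mem_cons] at hy
    rcases hy with rfl | hy
    · exact hx
    · exact hW y hy
  obtain ⟨z, hz⟩ : (reachWithin G W {u} m ∩ reachWithin G W {v} m).Nonempty := by
    rw [← Finset.card_pos]
    have h1 := hbig u hu
    have h2 := hbig v hv
    have h3 := Finset.card_union_add_card_inter (reachWithin G W {u} m) (reachWithin G W {v} m)
    have h4 : (reachWithin G W {u} m ∪ reachWithin G W {v} m).card ≤ W.card := by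
      refine Finset.card_le_card (Finset.union_subset ?_ ?_)
      · exact (reachWithin_subset W {u} m).trans (by simpa [Finset.insert_subset_iff] using hu)
      · exact (reachWithin_subset W {v} m).trans (by simpa [Finset.insert_subset_iff] using hv)
    omega
  rw [Finset.mem_inter] at hz
  obtain ⟨w₁, hl₁, hW₁⟩ := hwalk u hu z hz.1
  obtain ⟨w₂, hl₂, hW₂⟩ := hwalk v hv z hz.2
  refine ⟨w₁.append w₂.reverse, by simp; omega, fun x hx => ?_⟩
  rw [SimpleGraph.Walk.mem_support_append_iff, SimpleGraph.Walk.support_reverse,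
    List.mem_reverse] at hx
  exact hx.elim (hW₁ x) (hW₂ x)

/-- A family of walks from vertices `c ∈ A` to a set `B` that leave `P` at once: the walk of `c`
ends in `z c` and uses at most `t` further vertices, all of them in `D c`. The walks are not
disjoint, but no vertex is used by more than `l` of them. -/
structure IsExitSystem (G : SimpleGraph V) (P B A : Finset V) (D : V → Finset V) (z : V → V)
    (t l : ℕ) : Prop where
  subset : A ⊆ P
  disjoint : ∀ c ∈ A, Disjoint (D c) P
  card_le : ∀ c ∈ A, (D c).card ≤ t
  mem_target : ∀ c ∈ A, z c ∈ B
  mem_walk : ∀ c ∈ A, z c ∈ D c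
  walk : ∀ c ∈ A, ∃ w : G.Walk c (z c), ∀ x ∈ w.support.tail, x ∈ D c
  load : ∀ v, (A.filter (v ∈ D ·)).card ≤ l

/-- An expander has exit systems in which the proportion of vertices of `P` with an exit is
any `ρ < α / (1 + α)`. In a maximal exit system the vertices that are used `l` times are few, and if
the remaining vertices of `P` could reach `B` while avoiding them, another walk could be added;
but if they cannot, the set of vertices they reach grows by `ξ * |P|` in each step. -/
theorem ExpandsIn.exists_isExitSystem {α ρ ξ : ℝ} (h : ExpandsIn G Finset.univ α) (hα : 0 < α)
    {P B : Finset V} (hPB : Disjoint P B) {t l : ℕ} (hl : 0 < l)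
    (hρ : (1 + α) * ρ + 2 * ξ ≤ α) (htl : t ≤ ξ * l) (hB : 2 * Bᶜ.card ≤ Fintype.card V)
    (ht : (Bᶜ.card : ℝ) < t * (ξ * P.card)) :
    ∃ A D z, IsExitSystem G P B A D z t l ∧ ρ * P.card ≤ A.card := by
  classical
  set S : Finset (Finset V) := Finset.univ.filter fun A => ∃ D z, IsExitSystem G P B A D z t l
  have hne : S.Nonempty := by
    refine ⟨∅, Finset.mem_filter.2 ⟨Finset.mem_univ _, fun _ => ∅, id, ?_⟩⟩
    constructor <;> simp
  obtain ⟨A, hAS, hmax⟩ := S.exists_max_image Finset.card hne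
  obtain ⟨D, z, hA⟩ := (Finset.mem_filter.1 hAS).2
  refine ⟨A, D, z, hA, ?_⟩
  by_contra! hlt
  have hl' : (0 : ℝ) < l := by exact_mod_cast hl
  have hAP : A.card ≤ P.card := Finset.card_le_card hA.subset
  set Z : Finset V := Finset.univ.filter fun v => l ≤ (A.filter (v ∈ D ·)).card with hZ
  have hZc : (Z.card : ℝ) ≤ ξ * P.card := by
    have h1 : Z.card * l ≤ A.card * t := by
      calc Z.card * l ≤ ∑ v ∈ Z, (A.filter (v ∈ D ·)).card := by
            rw [← smul_eq_mul]
            exact Finset.card_nsmul_le_sum _ _ _ fun v hv => (Finset.mem_filter.1 hv).2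
        _ ≤ ∑ v, (A.filter (v ∈ D ·)).card :=
            Finset.sum_le_sum_of_subset (Finset.subset_univ _)
        _ = ∑ c ∈ A, (D c).card := by
            simp only [Finset.card_filter]
            rw [Finset.sum_comm]
            refine Finset.sum_congr rfl fun c _ => ?_
            rw [← Finset.card_filter]
            simp
        _ ≤ A.card * t := by
            rw [← smul_eq_mul]
            exact Finset.sum_le_card_nsmul _ _ _ hA.card_le
    have h2 : (Z.card : ℝ) * l ≤ P.card * t := by
      exact_mod_cast h1.trans (Nat.mul_le_mul_right _ hAP)
    have h3 : (P.card : ℝ) * t ≤ P.card * (ξ * l) := by gcongr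
    have h4 : (Z.card : ℝ) * l ≤ (ξ * P.card) * l := by linarith
    exact le_of_mul_le_mul_right h4 hl'
  set W : Finset V := (P ∪ Z)ᶜ with hW
  have havoid : ∀ j ≤ t, ∀ v ∈ reachWithin G W (P \ A) j, v ∉ B := by
    intro j hj v hv hvB
    obtain ⟨c, hc, w, hwl, hwW⟩ := exists_walk_of_mem_reachWithin hv
    rw [Finset.mem_sdiff] at hc
    have hvc : v ≠ c := fun heq => Finset.disjoint_left.1 hPB hc.1 (heq ▸ hvB)
    have hne : ∀ a ∈ A, a ≠ c := fun a ha heq => hc.2 (heq ▸ ha)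
    have hmem : insert c A ∈ S := by
      refine Finset.mem_filter.2 ⟨Finset.mem_univ _,
        Function.update D c w.support.tail.toFinset, Function.update z c v, ?_⟩
      have hcase : ∀ {p : V → Finset V → V → Prop}, p c w.support.tail.toFinset v →
          (∀ a ∈ A, p a (D a) (z a)) → ∀ a ∈ insert c A,
            p a (Function.update D c w.support.tail.toFinset a) (Function.update z c v a) := by
        intro p h1 h2 a ha
        rcases Finset.mem_insert.1 ha with rfl | ha
        · simpa using h1
        · simpa [Function.update_of_ne (hne a ha)] using h2 a ha
      refine ⟨Finset.insert_subset hc.1 hA.subset, ?_, ?_, ?_, ?_, ?_, ?_⟩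
      · refine hcase (p := fun _ E _ => Disjoint E P) ?_ hA.disjoint
        refine Finset.disjoint_left.2 fun x hx hxP => ?_
        have := hwW x (List.mem_toFinset.1 hx)
        simp [hW, hxP] at this
      · refine hcase (p := fun _ E _ => E.card ≤ t) ?_ hA.card_le
        refine (List.toFinset_card_le _).trans ?_
        simp only [List.length_tail, SimpleGraph.Walk.length_support]
        omega
      · exact hcase (p := fun _ _ y => y ∈ B) hvB hA.mem_target
      · refine hcase (p := fun _ E y => y ∈ E) ?_ hA.mem_walk
        have := w.end_mem_support
        rw [← SimpleGraph.Walk.cons_tail_support, List.mem_cons] at this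
        exact List.mem_toFinset.2 (this.resolve_left hvc)
      · exact hcase (p := fun a E y => ∃ w : G.Walk a y, ∀ x ∈ w.support.tail, x ∈ E)
          ⟨w, fun x hx => List.mem_toFinset.2 hx⟩ hA.walk
      · intro x
        have hcong : A.filter (x ∈ Function.update D c w.support.tail.toFinset ·) =
            A.filter (x ∈ D ·) :=
          Finset.filter_congr fun a ha => by rw [Function.update_of_ne (hne a ha)]
        rw [Finset.filter_insert, Function.update_self, hcong]
        split_ifs with hx
        · refine (Finset.card_insert_le _ _).trans ?_
          have := hwW x (List.mem_toFinset.1 hx)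
          simp only [hW, hZ, Finset.mem_compl, Finset.mem_union, Finset.mem_filter,
            Finset.mem_univ, true_and, not_or, not_le] at this
          exact this.2
        · exact hA.load x
    have := hmax _ hmem
    rw [Finset.card_insert_of_notMem hc.2] at this
    omega
  have hgrow : ∀ j ≤ t, j * (ξ * P.card) ≤ ((reachWithin G W (P \ A) j).card : ℝ) := by
    intro j
    induction j with
    | zero => intro _; simp
    | succ j ih =>
      intro hj
      have h0 := ih (by omega)
      set Y := reachWithin G W (P \ A) j with hY
      have hYB : Y ⊆ Bᶜ := fun v hv => Finset.mem_compl.2 (havoid j (by omega) v hv)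
      have h1 := h Y (Finset.subset_univ _) (by
        have := Finset.card_le_card hYB
        rw [Finset.card_univ]
        omega)
      rw [Finset.inter_univ] at h1
      have h2 : G.outerBoundary Y ⊆ (G.outerBoundary Y ∩ W) ∪ (A ∪ Z) := by
        intro v hv
        by_cases hvW : v ∈ W
        · exact Finset.mem_union_left _ (Finset.mem_inter.2 ⟨hv, hvW⟩)
        · refine Finset.mem_union_right _ ?_
          rw [hW, Finset.mem_compl, not_not, Finset.mem_union] at hvW
          rw [Finset.mem_union]
          refine hvW.imp_left fun hvP => ?_
          by_contra hvA
          exact (SimpleGraph.mem_outerBoundary.1 hv).1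
            (subset_reachWithin W (P \ A) j (Finset.mem_sdiff.2 ⟨hvP, hvA⟩))
      have h3 : ((G.outerBoundary Y).card : ℝ) ≤
          (G.outerBoundary Y ∩ W).card + (A.card + Z.card) := by
        have h4 := (Finset.card_le_card h2).trans (Finset.card_union_le _ _)
        have h5 := Finset.card_union_le A Z
        exact_mod_cast h4.trans (by omega)
      have h4 : (P.card : ℝ) - A.card ≤ Y.card := by
        have h5 := Finset.card_le_card (subset_reachWithin (G := G) W (P \ A) j)
        have h6 := Finset.card_sdiff_add_card_eq_card hA.subset
        have h7 : (P.card : ℝ) ≤ Y.card + A.card := by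
          rw [hY]
          exact_mod_cast (by omega : P.card ≤ (reachWithin G W (P \ A) j).card + A.card)
        linarith
      have h5 : α * (P.card - A.card) ≤ α * Y.card := by gcongr
      have h6 : (1 + α) * A.card ≤ (1 + α) * (ρ * P.card) := by gcongr
      have h7 : ((1 + α) * ρ + 2 * ξ) * P.card ≤ α * P.card := by gcongr
      rw [card_reachWithin_succ, ← hY]
      push_cast
      linarith
  have h1 := hgrow t le_rfl
  have h2 : ((reachWithin G W (P \ A) t).card : ℝ) ≤ Bᶜ.card := by
    exact_mod_cast Finset.card_le_card fun v hv => Finset.mem_compl.2 (havoid t le_rfl v hv)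
  linarith

end Expansion

/-! ### Long paths -/

section LongPath

variable {V : Type*} [Fintype V] [DecidableEq V] {G : SimpleGraph V}

/-- Depth-first search, stopped when equally many vertices are finished (`X`) and untouched (`Y`):
the stack is a path that separates the two sets. -/
theorem exists_balanced_separating_path (G : SimpleGraph V) :
    ∃ (X Y : Finset V) (p : List V), p.IsChain G.Adj ∧ p.Nodup ∧ Disjoint X Y ∧
      X.card = Y.card ∧ (∀ v, v ∈ X ∨ v ∈ Y ∨ v ∈ p) ∧ ∀ u ∈ X, ∀ v ∈ Y, ¬ G.Adj u v := by
  have main : ∀ j ≤ Fintype.card V, ∃ (X Y : Finset V) (p : List V), p.IsChain G.Adj ∧ p.Nodup ∧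
      Disjoint X Y ∧ X.card + Fintype.card V = Y.card + j ∧ (∀ v ∈ p, v ∉ X ∧ v ∉ Y) ∧
      (∀ v, v ∈ X ∨ v ∈ Y ∨ v ∈ p) ∧ ∀ u ∈ X, ∀ v ∈ Y, ¬ G.Adj u v := by
    intro j
    induction j with
    | zero =>
      intro _
      exact ⟨∅, Finset.univ, [], by simp, by simp, by simp, by simp [Finset.card_univ], by simp,
        by simp, by simp⟩
    | succ j ih =>
      intro hj
      obtain ⟨X, Y, p, hch, hnd, hXY, hc, hp, hcov, hno⟩ := ih (by omega)
      have hpush : ∀ y ∈ Y, (y :: p).IsChain G.Adj → ∃ (X Y : Finset V) (p : List V),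
          p.IsChain G.Adj ∧ p.Nodup ∧
          Disjoint X Y ∧ X.card + Fintype.card V = Y.card + (j + 1) ∧ (∀ v ∈ p, v ∉ X ∧ v ∉ Y) ∧
          (∀ v, v ∈ X ∨ v ∈ Y ∨ v ∈ p) ∧ ∀ u ∈ X, ∀ v ∈ Y, ¬ G.Adj u v := by
        intro y hy hyc
        refine ⟨X, Y.erase y, y :: p, hyc, List.nodup_cons.2 ⟨fun h => (hp y h).2 hy, hnd⟩,
          hXY.mono_right (Finset.erase_subset _ _), ?_, ?_, ?_, ?_⟩
        · have := Finset.card_erase_add_one hy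
          omega
        · intro v hv
          rcases List.mem_cons.1 hv with rfl | hv
          · exact ⟨Finset.disjoint_right.1 hXY hy, Finset.notMem_erase _ _⟩
          · exact ⟨(hp v hv).1, fun h => (hp v hv).2 (Finset.mem_of_mem_erase h)⟩
        · intro v
          rcases hcov v with h | h | h
          · exact Or.inl h
          · by_cases hvy : v = y
            · exact Or.inr (Or.inr (by simp [hvy]))
            · exact Or.inr (Or.inl (Finset.mem_erase.2 ⟨hvy, h⟩))
          · exact Or.inr (Or.inr (List.mem_cons_of_mem _ h))
        · exact fun u hu v hv => hno u hu v (Finset.mem_of_mem_erase hv)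
      match p, hch, hnd, hp, hcov, hpush with
      | [], _, _, _, _, hpush =>
        obtain ⟨y, hy⟩ : Y.Nonempty := Finset.card_pos.1 (by omega)
        exact hpush y hy (by simp)
      | v :: p, hch, hnd, hp, hcov, hpush =>
        by_cases hex : ∃ y ∈ Y, G.Adj v y
        · obtain ⟨y, hy, hvy⟩ := hex
          exact hpush y hy (List.isChain_cons_cons.2 ⟨hvy.symm, hch⟩)
        · push Not at hex
          have hv := hp v (by simp)
          refine ⟨insert v X, Y, p, hch.of_cons, (List.nodup_cons.1 hnd).2,
            Finset.disjoint_insert_left.2 ⟨hv.2, hXY⟩, ?_, ?_, ?_, ?_⟩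
          · rw [Finset.card_insert_of_notMem hv.1]
            omega
          · intro u hu
            refine ⟨?_, (hp u (List.mem_cons_of_mem _ hu)).2⟩
            rw [Finset.mem_insert, not_or]
            exact ⟨fun h => (List.nodup_cons.1 hnd).1 (h ▸ hu),
              (hp u (List.mem_cons_of_mem _ hu)).1⟩
          · intro u
            rcases hcov u with h | h | h
            · exact Or.inl (Finset.mem_insert_of_mem h)
            · exact Or.inr (Or.inl h)
            · rcases List.mem_cons.1 h with rfl | h
              · exact Or.inl (Finset.mem_insert_self _ _)
              · exact Or.inr (Or.inr h)
          · intro u hu y hy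
            rcases Finset.mem_insert.1 hu with rfl | hu
            · exact hex y hy
            · exact hno u hu y hy
  obtain ⟨X, Y, p, hch, hnd, hXY, hc, -, hcov, hno⟩ := main _ le_rfl
  exact ⟨X, Y, p, hch, hnd, hXY, by omega, hcov, hno⟩

theorem ExpandsIn.exists_long_path [DecidableRel G.Adj] {α : ℝ}
    (h : ExpandsIn G Finset.univ α) (hα : 0 < α) {N : ℕ} (hN : 0 < N)
    (hNα : (2 + α) * N ≤ α * Fintype.card V) :
    ∃ f : ℕ → V, Set.InjOn f (Set.Iio N) ∧ ∀ i, i + 1 < N → G.Adj (f i) (f (i + 1)) := by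
  obtain ⟨X, Y, p, hch, hnd, hXY, hc, hcov, hno⟩ := exists_balanced_separating_path G
  have hXYc : X.card + Y.card ≤ Fintype.card V := by
    rw [← Finset.card_union_of_disjoint hXY]
    exact Finset.card_le_univ _
  have h1 := h X (Finset.subset_univ _) (by rw [Finset.card_univ]; omega)
  rw [Finset.inter_univ] at h1
  have h2 : G.outerBoundary X ⊆ p.toFinset := by
    intro v hv
    obtain ⟨hvX, u, hu, huv⟩ := SimpleGraph.mem_outerBoundary.1 hv
    rw [List.mem_toFinset]
    rcases hcov v with h | h | h
    · exact absurd h hvX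
    · exact absurd huv (hno u hu v h)
    · exact h
  have h3 : ((G.outerBoundary X).card : ℝ) ≤ p.length := by
    exact_mod_cast (Finset.card_le_card h2).trans (List.toFinset_card_le _)
  have h4 : (Fintype.card V : ℝ) ≤ 2 * X.card + p.length := by
    have h5 : (Finset.univ : Finset V) ⊆ (X ∪ Y) ∪ p.toFinset := by
      intro v _
      simp only [Finset.mem_union, List.mem_toFinset]
      have := hcov v
      tauto
    have h6 := (Finset.card_le_card h5).trans (Finset.card_union_le _ _)
    have h7 := Finset.card_union_le X Y
    have h8 := List.toFinset_card_le p
    rw [Finset.card_univ] at h6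
    exact_mod_cast (by omega : Fintype.card V ≤ 2 * X.card + p.length)
  have h5 : N ≤ p.length := by
    have h6 : (2 + α) * N ≤ (2 + α) * p.length := by nlinarith
    exact_mod_cast le_of_mul_le_mul_left h6 (by linarith)
  obtain ⟨v₀⟩ : Nonempty V := ⟨p[0]⟩
  have hget : ∀ i, (hi : i < N) → p.getD i v₀ = p[i] := fun i hi =>
    List.getD_eq_getElem _ _ (by omega)
  refine ⟨fun i => p.getD i v₀, ?_, ?_⟩
  · intro i hi j hj hij
    simp only [Set.mem_Iio] at hi hj
    simp only [hget i hi, hget j hj] at hij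
    exact (hnd.getElem_inj_iff).1 hij
  · intro i hi
    simp only [hget i (by omega), hget (i + 1) hi]
    exact hch.getElem i (by omega)

end LongPath

/-! ### Linked paths in expanders -/

/-- A path of small linear size in an expander can be equipped with exits. They lead to an expanding
part `B` of the complement of the path, and the usable exits with respect to `F` are those whose walk
avoids `F` and ends in an expanding part of `B \ F`. -/
theorem ExpandsIn.exists_linkedPath {V : Type*} [Fintype V] [DecidableEq V] {G : SimpleGraph V}
    [DecidableRel G.Adj] {γ ρ ξ : ℝ} (h : ExpandsIn G Finset.univ (4 * γ)) (hγ : 0 < γ)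
    {N : ℕ} {f : ℕ → V} (hinj : Set.InjOn f (Set.Iio N))
    (hadj : ∀ i, i + 1 < N → G.Adj (f i) (f (i + 1))) (hN : 0 < N)
    (hNγ : N * (2 + 1 / (2 * γ)) ≤ γ * Fintype.card V)
    (hN₂ : 2 * (N * (1 + 1 / (2 * γ))) ≤ Fintype.card V)
    {t l m r s d : ℕ} (hl : 0 < l) (hρ : (1 + 4 * γ) * ρ + 2 * ξ ≤ 4 * γ) (htl : t ≤ ξ * l)
    (ht : 1 + 1 / (2 * γ) < t * ξ) (hm : m * (2 + 1 / γ) ≤ γ / 4 * Fintype.card V)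
    (hr : l * (m * (2 + 1 / γ)) < r) (hd : (Fintype.card V : ℝ) < (1 + γ) ^ d)
    (hs : 2 * t + 2 * d + 1 ≤ s) :
    ∃ A, LinkedPath G N f A r s m ∧ ρ * N ≤ A.card := by
  set P : Finset V := (Finset.range N).image f with hP
  have hinj' : Set.InjOn f (Finset.range N) := by simpa using hinj
  have hPc : P.card = N := by
    rw [hP, Finset.card_image_of_injOn hinj', Finset.card_range]
  have hfP : ∀ i < N, f i ∈ P := fun i hi => Finset.mem_image_of_mem f (Finset.mem_range.2 hi)
  rw [show 4 * γ = 2 * (2 * γ) by ring] at h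
  obtain ⟨B, hBP, hBc, hB⟩ := h.exists_core (by linarith) (F := P) (by
    rw [hPc, Finset.card_univ]; linarith)
  rw [← Finset.compl_eq_univ_sdiff, hPc] at hBc
  have hBc₂ : 2 * Bᶜ.card ≤ Fintype.card V := by
    have h1 : (2 : ℝ) * Bᶜ.card ≤ Fintype.card V := by linarith
    exact_mod_cast h1
  have hPB : Disjoint P B :=
    Finset.disjoint_right.2 fun v hv => (Finset.mem_sdiff.1 (hBP hv)).2
  obtain ⟨A, D, z, hA, hAc⟩ := h.exists_isExitSystem (ρ := ρ) (ξ := ξ) (t := t) (l := l)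
    (by linarith) hPB hl (by linarith) htl hBc₂ (by
      rw [hPc]
      have hN' : (0 : ℝ) < N := by exact_mod_cast hN
      nlinarith)
  have hBn : (Fintype.card V : ℝ) ≤ 2 * B.card := by
    have := Finset.card_add_card_compl B
    exact_mod_cast (by omega : Fintype.card V ≤ 2 * B.card)
  set I : Finset ℕ := (Finset.range N).filter (f · ∈ A) with hI
  have hIlt : ∀ i ∈ I, i < N ∧ f i ∈ A := fun i hi => by
    simpa [hI] using hi
  refine ⟨I, ⟨hinj, hadj, fun i hi => (hIlt i hi).1, ?_⟩, ?_⟩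
  · intro F hFm hFP
    have hFm' : (F.card : ℝ) ≤ m := by exact_mod_cast hFm
    have hFBm : (F ∩ B).card ≤ m := (Finset.card_le_card Finset.inter_subset_left).trans hFm
    have hγ' : 0 < 2 + 1 / γ := by positivity
    obtain ⟨B', hB'F, hB'c, hB'⟩ := hB.exists_core (by linarith) (F := F ∩ B) (by
        calc ((F ∩ B).card : ℝ) * (2 + 1 / γ) ≤ m * (2 + 1 / γ) := by
              gcongr
          _ ≤ γ / 4 * Fintype.card V := hm
          _ ≤ γ / 2 * B.card := by nlinarith)
    have hB'B : ∀ v ∈ B', v ∈ B ∧ v ∉ F := by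
      intro v hv
      have := hB'F hv
      simp only [Finset.mem_sdiff, Finset.mem_inter, not_and] at this
      exact ⟨this.1, fun hF => this.2 hF this.1⟩
    refine ⟨I.filter fun i => Disjoint (D (f i)) F ∧ z (f i) ∈ B', Finset.filter_subset _ _, ?_, ?_⟩
    · -- each vertex of `F` and each vertex lost from `B` spoils at most `l` exits
      have hsub : (I \ I.filter fun i => Disjoint (D (f i)) F ∧ z (f i) ∈ B').image f ⊆
          (F ∪ (B \ B')).biUnion fun v => A.filter (v ∈ D ·) := by
        intro c hc
        obtain ⟨i, hi, rfl⟩ := Finset.mem_image.1 hc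
        rw [Finset.mem_sdiff] at hi
        obtain ⟨hi, hbad⟩ := hi
        have hiA := (hIlt i hi).2
        rw [Finset.mem_biUnion]
        by_cases hdis : Disjoint (D (f i)) F
        · have hz : z (f i) ∉ B' := fun hz =>
            hbad (Finset.mem_filter.2 ⟨hi, hdis, hz⟩)
          exact ⟨z (f i), Finset.mem_union_right _
            (Finset.mem_sdiff.2 ⟨hA.mem_target _ hiA, hz⟩),
            Finset.mem_filter.2 ⟨hiA, hA.mem_walk _ hiA⟩⟩
        · obtain ⟨v, hvD, hvF⟩ := Finset.not_disjoint_iff.1 hdis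
          exact ⟨v, Finset.mem_union_left _ hvF, Finset.mem_filter.2 ⟨hiA, hvD⟩⟩
      have h1 := Finset.card_le_card hsub
      rw [Finset.card_image_of_injOn (hinj.mono fun i hi => by
        simp only [Finset.coe_sdiff, Set.mem_sdiff, Finset.mem_coe] at hi
        exact (hIlt i hi.1).1)] at h1
      have h2 := h1.trans (Finset.card_biUnion_le_card_mul _ _ l fun v _ => hA.load v)
      have h3 := h2.trans (Nat.mul_le_mul_right l (Finset.card_union_le F (B \ B')))
      have h4 : ((F.card + (B \ B').card : ℕ) : ℝ) ≤ m * (2 + 1 / γ) := by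
        push_cast
        calc (F.card : ℝ) + (B \ B').card ≤ F.card + (F ∩ B).card * (1 + 1 / γ) := by gcongr
          _ ≤ m + m * (1 + 1 / γ) := by gcongr
          _ = m * (2 + 1 / γ) := by ring
      have h5 : (((F.card + (B \ B').card) * l : ℕ) : ℝ) < r := by
        rw [Nat.cast_mul]
        have h6 : ((F.card + (B \ B').card : ℕ) : ℝ) * l ≤ m * (2 + 1 / γ) * l := by gcongr
        linarith
      exact h3.trans_lt (by exact_mod_cast h5)
    · intro i hi j hj hij
      rw [Finset.mem_filter] at hi hj
      obtain ⟨hi, hiF, hiB⟩ := hi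
      obtain ⟨hj, hjF, hjB⟩ := hj
      obtain ⟨hiN, hiA⟩ := hIlt i hi
      obtain ⟨hjN, hjA⟩ := hIlt j hj
      have hBcard : (B'.card : ℝ) < (1 + γ) ^ d :=
        lt_of_le_of_lt (by exact_mod_cast Finset.card_le_univ B') hd
      obtain ⟨w₀, hw₀, hw₀B⟩ := hB'.exists_walk hγ hBcard hiB hjB
      obtain ⟨w₁, hw₁⟩ := hA.walk _ hiA
      obtain ⟨w₂, hw₂⟩ := hA.walk _ hjA
      set w := (w₁.append (w₀.append w₂.reverse)).bypass with hw
      set E : Finset V := D (f i) ∪ D (f j) ∪ w₀.support.toFinset with hE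
      have hsupp : ∀ x ∈ w.support, x = f i ∨ x = f j ∨ x ∈ E := by
        intro x hx
        have hx' := SimpleGraph.Walk.support_bypass_subset_support _ hx
        simp only [SimpleGraph.Walk.mem_support_append_iff, SimpleGraph.Walk.support_reverse,
          List.mem_reverse] at hx'
        simp only [hE, Finset.mem_union, List.mem_toFinset]
        rcases hx' with hx' | hx' | hx'
        · rw [← SimpleGraph.Walk.cons_tail_support, List.mem_cons] at hx'
          rcases hx' with h | h
          · exact Or.inl h
          · exact Or.inr (Or.inr (Or.inl (Or.inl (hw₁ x h))))
        · exact Or.inr (Or.inr (Or.inr hx'))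
        · rw [← SimpleGraph.Walk.cons_tail_support, List.mem_cons] at hx'
          rcases hx' with h | h
          · exact Or.inr (Or.inl h)
          · exact Or.inr (Or.inr (Or.inl (Or.inr (hw₂ x h))))
      refine ⟨E, ?_, ?_, ?_, w.length, w, SimpleGraph.Walk.bypass_isPath _, ?_, rfl⟩
      · have h1 := Finset.card_union_le (D (f i) ∪ D (f j)) w₀.support.toFinset
        have h2 := Finset.card_union_le (D (f i)) (D (f j))
        have h3 := hA.card_le _ hiA
        have h4 := hA.card_le _ hjA
        have h5 := List.toFinset_card_le w₀.support
        rw [SimpleGraph.Walk.length_support] at h5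
        rw [← hE] at h1
        omega
      · rw [hE, Finset.disjoint_union_left, Finset.disjoint_union_left]
        refine ⟨⟨hiF, hjF⟩, Finset.disjoint_left.2 fun x hx => ?_⟩
        exact (hB'B x (hw₀B x (List.mem_toFinset.1 hx))).2
      · intro c hc hcE
        have hcP := hfP c hc
        rw [hE, Finset.mem_union, Finset.mem_union] at hcE
        rcases hcE with (h | h) | h
        · exact Finset.disjoint_left.1 (hA.disjoint _ hiA) h hcP
        · exact Finset.disjoint_left.1 (hA.disjoint _ hjA) h hcP
        · exact Finset.disjoint_left.1 hPB hcP (hB'B _ (hw₀B _ (List.mem_toFinset.1 h))).1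
      · intro x hx
        simpa using hsupp x hx
  · rw [hPc] at hAc
    have hAI : A ⊆ I.image f := by
      intro c hc
      obtain ⟨i, hi, rfl⟩ := Finset.mem_image.1 (hA.subset hc)
      exact Finset.mem_image_of_mem f (Finset.mem_filter.2 ⟨hi, hc⟩)
    have h1 : (A.card : ℝ) ≤ I.card := by
      exact_mod_cast (Finset.card_le_card hAI).trans Finset.card_image_le
    linarith

/-! ### Choice of the constants -/

/-- If `A` is dense in `[0, M * L)`, then it is dense in `k` of the `M` blocks of length `L`. -/
theorem exists_dense_blocks {A : Finset ℕ} {M L k p τ : ℕ} (hA : ∀ i ∈ A, i < M * L)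
    (hcard : k * (p * L) + M * τ < p * A.card) :
    ∃ x : ℕ → ℕ, (∀ j < k, x j + L ≤ M * L) ∧ (∀ j, j + 1 < k → x j + L ≤ x (j + 1)) ∧
      ∀ j < k, τ ≤ p * (A.filter (· ∈ Finset.Ico (x j) (x j + L))).card := by
  classical
  have hL : 0 < L := by
    rw [Nat.pos_iff_ne_zero]
    rintro rfl
    have hA₀ : A = ∅ := Finset.eq_empty_of_forall_notMem fun i hi => by simpa using hA i hi
    simp [hA₀] at hcard
  set I : ℕ → Finset ℕ := fun j => A.filter (· ∈ Finset.Ico (j * L) (j * L + L)) with hI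
  set S := (Finset.range M).filter fun j => τ ≤ p * (I j).card with hS
  have hkS : k ≤ S.card := by
    by_contra! hlt
    have h1 : A.card ≤ ∑ j ∈ Finset.range M, (I j).card := by
      refine (Finset.card_le_card fun i hi => ?_).trans Finset.card_biUnion_le
      rw [Finset.mem_biUnion]
      refine ⟨i / L, Finset.mem_range.2 ((Nat.div_lt_iff_lt_mul hL).2 (hA i hi)), ?_⟩
      have h1 := Nat.div_add_mod' i L
      have h2 := Nat.mod_lt i hL
      exact Finset.mem_filter.2 ⟨hi, Finset.mem_Ico.2 ⟨by omega, by omega⟩⟩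
    have h2 : ∀ j, (I j).card ≤ L := fun j => by
      have h3 : I j ⊆ Finset.Ico (j * L) (j * L + L) := fun i hi => (Finset.mem_filter.1 hi).2
      simpa using Finset.card_le_card h3
    have h3 : p * A.card ≤ ∑ j ∈ Finset.range M, p * (I j).card := by
      rw [← Finset.mul_sum]
      exact Nat.mul_le_mul_left p h1
    have h4 : ∑ j ∈ Finset.range M, p * (I j).card ≤ S.card * (p * L) + M * τ := by
      rw [← Finset.sum_filter_add_sum_filter_not _ fun j => τ ≤ p * (I j).card]
      refine Nat.add_le_add ?_ ?_
      · rw [← smul_eq_mul S.card]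
        exact Finset.sum_le_card_nsmul _ _ _ fun j _ => Nat.mul_le_mul_left p (h2 j)
      · refine (Finset.sum_le_card_nsmul _ _ τ fun j hj => ?_).trans ?_
        · exact (not_le.1 (Finset.mem_filter.1 hj).2).le
        · rw [smul_eq_mul]
          refine Nat.mul_le_mul_right τ ((Finset.card_filter_le _ _).trans ?_)
          rw [Finset.card_range]
    have h5 : S.card * (p * L) ≤ k * (p * L) := Nat.mul_le_mul_right _ hlt.le
    omega
  have hfin : (Set.ofPred (· ∈ S)).Finite := S.finite_toSet
  have hcardS : ∀ {j}, j < k → j < hfin.toFinset.card := fun hj => by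
    have : hfin.toFinset = S := Finset.ext fun j => hfin.mem_toFinset
    rw [this]
    omega
  have hmem : ∀ j < k, Nat.nth (· ∈ S) j < M ∧ τ ≤ p * (I (Nat.nth (· ∈ S) j)).card := by
    intro j hj
    simpa [hS] using Nat.nth_mem_of_lt_card hfin (hcardS hj)
  refine ⟨fun j => Nat.nth (· ∈ S) j * L, fun j hj => ?_, fun j hj => ?_,
    fun j hj => (hmem j hj).2⟩
  · have h1 := Nat.mul_le_mul_right L (Nat.succ_le_iff.2 (hmem j hj).1)
    rwa [Nat.succ_mul] at h1
  · have h1 := Nat.mul_le_mul_right L (Nat.succ_le_iff.2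
      (Nat.nth_lt_nth_of_lt_card hfin (Nat.lt_succ_self j) (hcardS hj)))
    rwa [Nat.succ_mul] at h1

/-- Large expanders contain linked paths in which the exits have any density `ρ < 4γ / (1 + 4γ)`
and all sizes are proportional to a parameter `d`. The number `M` of blocks and the ratio of the
block length `b * d` to the number `a * d` of exits that may be spoiled can be made as large as
desired. -/
theorem exists_linkedPath_of_large {γ ρ ξ η : ℝ} (hγ : 0 < γ) (hξ : 0 < ξ)
    (hξρ : (1 + 4 * γ) * ρ + 2 * ξ ≤ 4 * γ) (hη : 0 < η) (k : ℕ) :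
    ∃ a b M n₀ : ℕ, (3 * a + 2) * 2 < b * η ∧ 2 * k < M * η ∧
      ∀ (V : Type*) [Fintype V] [DecidableEq V] (G : SimpleGraph V) [DecidableRel G.Adj],
        n₀ ≤ Fintype.card V → ExpandsIn G Finset.univ (4 * γ) →
          ∃ (d : ℕ) (f : ℕ → V) (A : Finset ℕ), 0 < d ∧
            LinkedPath G (M * (b * d)) f A (a * d) (3 * d) (2 * k * (3 * d)) ∧
            ρ * (M * (b * d) : ℕ) ≤ A.card := by
  obtain ⟨t, ht⟩ := exists_nat_gt ((1 + 1 / (2 * γ)) / ξ)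
  rw [div_lt_iff₀ hξ] at ht
  obtain ⟨l, hl⟩ := exists_nat_gt (t / ξ)
  have hl₀ : 0 < l := by
    have : (0 : ℝ) < l := lt_of_le_of_lt (by positivity) hl
    exact_mod_cast this
  rw [div_lt_iff₀ hξ] at hl
  obtain ⟨a, ha⟩ := exists_nat_gt (l * (2 * k * 3 * (2 + 1 / γ)))
  obtain ⟨b, hb⟩ := exists_nat_gt ((3 * a + 2) * 2 / η)
  have hb₀ : (0 : ℝ) < b := lt_of_le_of_lt (by positivity) hb
  rw [div_lt_iff₀ hη] at hb
  obtain ⟨M, hM⟩ := exists_nat_gt (2 * k / η)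
  have hM₀ : (0 : ℝ) < M := lt_of_le_of_lt (by positivity) hM
  rw [div_lt_iff₀ hη] at hM
  -- the lower bounds on `n / d` that the four size conditions below ask for
  obtain ⟨c₁, hc₁⟩ : ∃ c : ℝ, c = M * b * (2 + 1 / (2 * γ)) / γ := ⟨_, rfl⟩
  obtain ⟨c₂, hc₂⟩ : ∃ c : ℝ, c = 2 * (M * b * (1 + 1 / (2 * γ))) := ⟨_, rfl⟩
  obtain ⟨c₃, hc₃⟩ : ∃ c : ℝ, c = 2 * k * 3 * (2 + 1 / γ) / (γ / 4) := ⟨_, rfl⟩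
  obtain ⟨c₄, hc₄⟩ : ∃ c : ℝ, c = (2 + 4 * γ) * (M * b) / (4 * γ) := ⟨_, rfl⟩
  have h₁ : 0 ≤ c₁ := by rw [hc₁]; positivity
  have h₂ : 0 ≤ c₂ := by rw [hc₂]; positivity
  have h₃ : 0 ≤ c₃ := by rw [hc₃]; positivity
  have h₄ : 0 ≤ c₄ := by rw [hc₄]; positivity
  obtain ⟨q, hq⟩ := exists_nat_gt (c₁ + c₂ + c₃ + c₄)
  have hq₀ : (0 : ℝ) < q := lt_of_le_of_lt (by positivity) hq
  have hq₀' : 0 < q := by exact_mod_cast hq₀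
  obtain ⟨d₀, hd₀⟩ : ∃ d₀ : ℕ, ∀ d ≥ d₀, 2 * q * (d : ℝ) < (1 + γ) ^ d := by
    have h1 := tendsto_pow_const_div_const_pow_of_one_lt 1 (show 1 < 1 + γ by linarith)
    have h2 := h1.eventually (gt_mem_nhds (show 0 < 1 / (2 * (q : ℝ)) by positivity))
    obtain ⟨d₀, hd₀⟩ := Filter.eventually_atTop.1 h2
    refine ⟨d₀, fun d hd => ?_⟩
    have h3 := hd₀ d hd
    rw [pow_one, div_lt_div_iff₀ (by positivity) (by positivity)] at h3
    linarith
  refine ⟨a, b, M, q * (d₀ + 2 * t + 1), hb, hM, fun V _ _ G _ hn hG => ?_⟩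
  obtain ⟨n, hnV⟩ : ∃ n, n = Fintype.card V := ⟨_, rfl⟩
  rw [← hnV] at hn
  obtain ⟨d, hd⟩ : ∃ d, d = n / q := ⟨_, rfl⟩
  have hdn : d₀ + 2 * t + 1 ≤ d := by
    rw [hd, Nat.le_div_iff_mul_le hq₀', mul_comm]
    exact hn
  have hqd : (q : ℝ) * d ≤ n := by
    rw [hd]
    exact_mod_cast Nat.mul_div_le n q
  have hnq : (n : ℝ) < q * (d + 1) := by
    rw [hd]
    exact_mod_cast Nat.lt_mul_div_succ n hq₀'
  have hd1 : (1 : ℝ) ≤ d := by exact_mod_cast (by omega : 1 ≤ d)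
  have hscale : ∀ c : ℝ, c ≤ c₁ + c₂ + c₃ + c₄ → c * d ≤ n := fun c hc =>
    (mul_le_mul_of_nonneg_right (hc.trans hq.le) (by linarith)).trans hqd
  have hN : (((M * (b * d) : ℕ) : ℝ)) = M * b * d := by push_cast; ring
  have hN₀ : 0 < M * (b * d) := by
    have : (0 : ℝ) < ((M * (b * d) : ℕ) : ℝ) := by rw [hN]; positivity
    exact_mod_cast this
  have size₁ : ((M * (b * d) : ℕ) : ℝ) * (2 + 1 / (2 * γ)) ≤ γ * Fintype.card V := by
    have h5 := hscale c₁ (by linarith)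
    rw [hc₁, div_mul_eq_mul_div, div_le_iff₀ hγ] at h5
    rw [hN, ← hnV]
    linarith
  have size₂ : 2 * (((M * (b * d) : ℕ) : ℝ) * (1 + 1 / (2 * γ))) ≤ Fintype.card V := by
    have h5 := hscale c₂ (by linarith)
    rw [hc₂] at h5
    rw [hN, ← hnV]
    linarith
  have size₃ : ((2 * k * (3 * d) : ℕ) : ℝ) * (2 + 1 / γ) ≤ γ / 4 * Fintype.card V := by
    have h5 := hscale c₃ (by linarith)
    rw [hc₃, div_mul_eq_mul_div, div_le_iff₀ (by linarith)] at h5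
    rw [← hnV]
    push_cast
    linarith
  have size₄ : (2 + 4 * γ) * ((M * (b * d) : ℕ) : ℝ) ≤ 4 * γ * Fintype.card V := by
    have h5 := hscale c₄ (by linarith)
    rw [hc₄, div_mul_eq_mul_div, div_le_iff₀ (by linarith)] at h5
    rw [hN, ← hnV]
    linarith
  have hr : (l : ℝ) * ((2 * k * (3 * d) : ℕ) * (2 + 1 / γ)) < (a * d : ℕ) := by
    push_cast
    calc (l : ℝ) * (2 * k * (3 * d) * (2 + 1 / γ)) = l * (2 * k * 3 * (2 + 1 / γ)) * d := by ring
      _ < a * d := by gcongr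
  have hpow : (Fintype.card V : ℝ) < (1 + γ) ^ d := by
    have h5 := hd₀ d (by omega)
    have h6 : (q : ℝ) * 1 ≤ q * d := by gcongr
    rw [← hnV]
    linarith
  obtain ⟨f, hinj, hadj⟩ := hG.exists_long_path (by linarith) hN₀ size₄
  obtain ⟨A, hA, hAc⟩ := hG.exists_linkedPath (ρ := ρ) (ξ := ξ) hγ hinj hadj hN₀ size₁ size₂
    (s := 3 * d) hl₀ hξρ (by linarith) ht size₃ hr hpow (by omega)
  exact ⟨d, f, A, by omega, hA, hAc⟩

theorem exists_cycle_length_modEq_of_odd {k : ℕ} (hk : 1 < k) (hodd : Odd k) {α : ℝ}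
    (hα : 1 / ((k.minFac : ℝ) - 1) < α) :
    ∃ n₀ : ℕ, ∀ (V : Type*) [Fintype V] [DecidableEq V] (G : SimpleGraph V) [DecidableRel G.Adj],
      n₀ ≤ Fintype.card V → ExpandsIn G Finset.univ α →
        ∀ r : ℕ, ∃ (v : V) (c : G.Walk v v), c.IsCycle ∧ c.length ≡ r [MOD k] := by
  have hp2 : (2 : ℝ) ≤ k.minFac := by exact_mod_cast (Nat.minFac_prime (by omega)).two_le
  obtain ⟨p, hp⟩ : ∃ p : ℝ, p = k.minFac := ⟨_, rfl⟩
  rw [← hp] at hp2 hα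
  have hα₀ : 0 < α := lt_trans (by apply one_div_pos.2; linarith) hα
  have hlt : 1 / p < α / (1 + α) := by
    rw [div_lt_iff₀ (by linarith)] at hα
    rw [div_lt_div_iff₀ (by linarith) (by linarith)]
    linarith
  obtain ⟨ρ, hρ₁, hρ₂⟩ := exists_between hlt
  rw [lt_div_iff₀ (by linarith)] at hρ₂
  obtain ⟨η, hη, hρ⟩ : ∃ η, 0 < η ∧ ρ = 1 / p + η := ⟨ρ - 1 / p, by linarith, by ring⟩
  obtain ⟨ξ, hξ, hξρ⟩ : ∃ ξ, 0 < ξ ∧ (1 + α) * ρ + 2 * ξ = α :=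
    ⟨(α - (1 + α) * ρ) / 2, by linarith, by ring⟩
  obtain ⟨γ, hγ, rfl⟩ : ∃ γ, 0 < γ ∧ 4 * γ = α := ⟨α / 4, by linarith, by ring⟩
  obtain ⟨a, b, M, n₀, hb, hM, hlarge⟩ := exists_linkedPath_of_large hγ hξ hξρ.le hη k
  refine ⟨n₀, fun V _ _ G _ hn hG r => ?_⟩
  obtain ⟨d, f, A, hd, hA, hAc⟩ := hlarge V G hn hG
  have hd1 : (1 : ℝ) ≤ d := by exact_mod_cast hd
  have hb₀ : (0 : ℝ) < b := by
    refine pos_of_mul_pos_left (lt_of_le_of_lt ?_ hb) hη.le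
    positivity
  obtain ⟨x, hx, hdisj, hcard⟩ := exists_dense_blocks (A := A) (M := M) (L := b * d) (k := k)
    (p := k.minFac) (τ := b * d + k.minFac * (3 * (a * d) + 2)) hA.lt (by
      -- `η` exceeds the loss from spoiled exits and from `k` full blocks by a factor of two each
      have h6 : (3 * (a * d) + 2 : ℝ) ≤ b * η / 2 * d := by
        have h7 : (3 * a + 2) * (d : ℝ) ≤ b * η / 2 * d := by gcongr; linarith
        linarith
      have h7 : (M : ℝ) * (p * (3 * (a * d) + 2)) ≤ M * (p * (b * η / 2 * d)) := by gcongr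
      have h8 : (k : ℝ) * (p * (b * d)) < M * η / 2 * (p * (b * d)) := by
        gcongr; linarith
      have h9 : p * (ρ * ((M * (b * d) : ℕ) : ℝ)) ≤ p * A.card := by gcongr
      have h10 : p * (ρ * ((M * (b * d) : ℕ) : ℝ)) = M * (b * d) + p * η * (M * (b * d)) := by
        rw [hρ]
        push_cast
        field_simp
      rw [← Nat.cast_lt (α := ℝ)]
      push_cast
      rw [← hp]
      linarith)
  exact hA.exists_isCycle hk hodd x (b * d) hx hdisj hcard r

/-! ### Cycles of all residues -/

theorem IsExpanding.expandsIn {V : Type*} [Fintype V] [DecidableEq V] {G : SimpleGraph V}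
    [DecidableRel G.Adj] {α : ℝ} (h : IsExpanding α G) : ExpandsIn G Finset.univ α := by
  intro Y _ hY
  have h1 := h (Y : Set V) (by
    rw [Set.ncard_coe_finset, Nat.card_eq_fintype_card, le_div_iff₀ (by norm_num)]
    rw [Finset.card_univ] at hY
    exact_mod_cast (by omega : Y.card * 2 ≤ Fintype.card V))
  have h2 : externalNeighborhood G (Y : Set V) = ((G.outerBoundary Y : Finset V) : Set V) := by
    ext v
    simp [externalNeighborhood, SimpleGraph.mem_outerBoundary]
  rw [h2, Set.ncard_coe_finset, Set.ncard_coe_finset] at h1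
  rwa [Finset.inter_univ]

/-- For `α > 1` half of the vertices cannot have `α` times as many outer neighbours. -/
theorem ExpandsIn.sub_one_mul_card_le {V : Type*} [Fintype V] [DecidableEq V] {G : SimpleGraph V}
    [DecidableRel G.Adj] {α : ℝ} (h : ExpandsIn G Finset.univ α) (hα : 1 < α) :
    (α - 1) * Fintype.card V ≤ α + 1 := by
  obtain ⟨X, -, hX⟩ := Finset.exists_subset_card_eq
    (show Fintype.card V / 2 ≤ (Finset.univ : Finset V).card by rw [Finset.card_univ]; omega)
  have h1 := h X (Finset.subset_univ _) (by rw [Finset.card_univ]; omega)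
  have h2 : (G.outerBoundary X ∩ Finset.univ).card + X.card ≤ Fintype.card V := by
    rw [Finset.inter_univ, ← Finset.card_union_of_disjoint]
    · exact Finset.card_le_univ _
    · exact Finset.disjoint_left.2 fun v hv => (SimpleGraph.mem_outerBoundary.1 hv).1
  have h3 : ((G.outerBoundary X ∩ Finset.univ).card : ℝ) + X.card ≤ Fintype.card V := by
    exact_mod_cast h2
  have h4 : (Fintype.card V : ℝ) ≤ 2 * X.card + 1 := by
    exact_mod_cast (by omega : Fintype.card V ≤ 2 * X.card + 1)
  nlinarith

theorem theorem2 (k : ℕ) (hk : 1 < k) (α : ℝ) (hα : 1 / ((k.minFac : ℝ) - 1) < α) :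
    ∃ n₀ : ℕ, ∀ r : ℕ, r < k →
      ∀ (V : Type*) [Finite V] (G : SimpleGraph V),
        n₀ ≤ Nat.card V → IsExpanding α G →
          ∃ (v : V) (c : G.Walk v v), c.IsCycle ∧ c.length ≡ r [MOD k] := by
  classical
  rcases Nat.even_or_odd k with heven | hodd
  · rw [(Nat.minFac_eq_two_iff k).2 heven.two_dvd] at hα
    have hα₁ : 1 < α := by norm_num at hα; exact hα
    obtain ⟨n₀, hn₀⟩ := exists_nat_gt ((α + 1) / (α - 1))
    rw [div_lt_iff₀ (by linarith)] at hn₀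
    refine ⟨n₀, fun r _ V _ G hn hG => ?_⟩
    have := Fintype.ofFinite V
    rw [Nat.card_eq_fintype_card] at hn
    have h1 := hG.expandsIn.sub_one_mul_card_le hα₁
    have h2 : (n₀ : ℝ) ≤ Fintype.card V := by exact_mod_cast hn
    nlinarith
  · obtain ⟨n₀, hn₀⟩ := exists_cycle_length_modEq_of_odd hk hodd hα
    refine ⟨n₀, fun r _ V _ G hn hG => ?_⟩
    have := Fintype.ofFinite V
    rw [Nat.card_eq_fintype_card] at hn
    exact hn₀ V G hn hG.expandsIn r
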